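/- For $\alpha\in\mathbb C\setminus\{0\}$ consider the lattice equation $$(u_{n+1,m+1}+1)(u_{n,m}-1)u_{n,m+1}=\alpha\,(u_{n,m+1}+1)(u_{n+1,m}-1)u_{n,m},\qquad n,m\in\mathbb Z, \tag{$*$}$$ for an unknown $u:\mathbb Z^2\to\mathbb C$. A first integral of $(*)$ of order $k\ge 1$ in the first direction is a family of functions $W_1=w_{n,m}(u_{n,m},u_{n+1,m},\dots,u_{n+k,m})$, $n,m\in\mathbb Z$, each $w_{n,m}$ holomorphic on a dense open subset of $\mathbb C^{k+1}$, such that $\partial w_{n,m}/\partial u_{n,m}\not\equiv0$ for some $n,m$, $\partial w_{n,m}/\partial u_{n+k,m}\not\equiv0$ for some $n,m$, and, on every solution of $(*)$, the values of $W_1$ at $(n,m)$ and $(n,m+1)$ coincide whenever both are defined. A first integral of order $l\ge1$ in the second direction is, likewise, a family $W_2=w_{n,m}(u_{n,m},u_{n,m+1},\dots,u_{n,m+l})$ that depends on $u_{n,m}$ and on $u_{n,m+l}$ in the same sense and whose values at $(n,m)$ and $(n+1,m)$ coincide on every solution. The equation is Darboux integrable if it has first integrals in both directions. **Theorem.** Let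 $N\ge1$ and let $\alpha\in\mathbb C$ satisfy $\alpha^N=-1$ and $\alpha^j\ne-1$ for $1\le j<N$. Then: 1. Equation $(*)$ is Darboux integrable. Explicitly, let $\sum_{i=0}^{N+1}a_iX^i=(X-1)\prod_{j=0}^{N-1}(X+\alpha^j)$, let $\sum_{i=0}^{N}b_{i,n}X^i=(X+\alpha^n)\prod_{j=1}^{N-1}(X-\alpha^{n-j})$, and let $Z_{n,m}=\alpha^n\frac{u_{n,m}-1}{u_{n,m+1}+1}$. Then $$W_1=\alpha^{-m}\,\frac{\sum_{i=0}^{N+1}a_i\prod_{r=0}^{i}u_{n+r,m}}{\sum_{i=0}^{N+1}a_i\prod_{r=0}^{i-1}u_{n+r,m}},\qquad W_2=\frac{\sum_{i=0}^{N}b_{i,n}\prod_{r=0}^{i}Z_{n,m+r}}{\sum_{i=0}^{N}b_{i,n}\prod_{r=0}^{i-1}Z_{n,m+r}}$$ are first integrals of order $N+1$ in the first and in the second direction, respectively. 2. In each of the two directions, the minimal order of a first integral of $(*)$ equals $N$ or $N+1$. Consequently, for every $M\in\mathbb N$ there is an $\alpha\ne0$ for which $(*)$ is Darboux integrable and the minimal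 orders of its first integrals in both directions are at least $M$. -/

import Mathlib

/-- The set of solutions `u : ℤ × ℤ → ℂ` of the Burgers-type lattice equation with parameter `α`. -/
def burgersSolutions (α : ℂ) : Set (ℤ → ℤ → ℂ) :=
  {u | ∀ n m : ℤ,
    (u (n + 1) (m + 1) + 1) * (u n m - 1) * u n (m + 1)
      = α * (u n (m + 1) + 1) * (u (n + 1) m - 1) * u n m}

/-- The tuple `(u_{n,m}, u_{n+1,m}, …, u_{n+k,m})`. -/
def rowTuple (u : ℤ → ℤ → ℂ) (k : ℕ) (n m : ℤ) : Fin (k + 1) → ℂ :=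
  fun i => u (n + (i : ℕ)) m

/-- The tuple `(u_{n,m}, u_{n,m+1}, …, u_{n,m+l})`. -/
def colTuple (u : ℤ → ℤ → ℂ) (l : ℕ) (n m : ℤ) : Fin (l + 1) → ℂ :=
  fun i => u n (m + (i : ℕ))

/-- `w = (w_{n,m})` is a family of functions of `k + 1 ≥ 2` complex variables, each `w_{n,m}`
holomorphic on the dense open set `D_{n,m}`, and the family has order exactly `k`: the partial
derivative with respect to the first variable is nonzero for at least some `n, m`, and so is the
one with respect to the last variable. This covers rational and meromorphic functions as well as
branches of multivalued functions; off `D_{n,m}` the values of `w_{n,m}` carry no information. -/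
structure IsFamilyOfOrder (k : ℕ) (w : ℤ → ℤ → (Fin (k + 1) → ℂ) → ℂ)
    (D : ℤ → ℤ → Set (Fin (k + 1) → ℂ)) : Prop where
  one_le : 1 ≤ k
  isOpen : ∀ n m, IsOpen (D n m)
  dense : ∀ n m, Dense (D n m)
  holomorphic : ∀ n m, AnalyticOnNhd ℂ (w n m) (D n m)
  deriv_first : ∃ n m, ∃ x ∈ D n m, fderiv ℂ (w n m) x (Pi.single 0 1) ≠ 0
  deriv_last : ∃ n m, ∃ x ∈ D n m, fderiv ℂ (w n m) x (Pi.single (Fin.last k) 1) ≠ 0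

/-- `W_{n,m} = w_{n,m}(u_{n,m}, …, u_{n+k,m})` is a first integral of order `k` in the first
direction of the lattice equation with solution set `S`: the relation `(T₂ - 1) W = 0` holds on all
solutions, wherever both sides are defined. -/
def IsFirstIntegral₁ (S : Set (ℤ → ℤ → ℂ)) (k : ℕ)
    (w : ℤ → ℤ → (Fin (k + 1) → ℂ) → ℂ) : Prop :=
  ∃ D : ℤ → ℤ → Set (Fin (k + 1) → ℂ), IsFamilyOfOrder k w D ∧
    ∀ u ∈ S, ∀ n m : ℤ, rowTuple u k n m ∈ D n m → rowTuple u k n (m + 1) ∈ D n (m + 1) →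
      w n (m + 1) (rowTuple u k n (m + 1)) = w n m (rowTuple u k n m)

/-- `W_{n,m} = w_{n,m}(u_{n,m}, …, u_{n,m+l})` is a first integral of order `l` in the second
direction of the lattice equation with solution set `S`: the relation `(T₁ - 1) W = 0` holds on all
solutions, wherever both sides are defined. -/
def IsFirstIntegral₂ (S : Set (ℤ → ℤ → ℂ)) (l : ℕ)
    (w : ℤ → ℤ → (Fin (l + 1) → ℂ) → ℂ) : Prop :=
  ∃ D : ℤ → ℤ → Set (Fin (l + 1) → ℂ), IsFamilyOfOrder l w D ∧
    ∀ u ∈ S, ∀ n m : ℤ, colTuple u l n m ∈ D n m → colTuple u l (n + 1) m ∈ D (n + 1) m →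
      w (n + 1) m (colTuple u l (n + 1) m) = w n m (colTuple u l n m)

/-- The orders of the first integrals in the first direction. -/
def firstIntegralOrders₁ (S : Set (ℤ → ℤ → ℂ)) : Set ℕ :=
  {k | ∃ w, IsFirstIntegral₁ S k w}

/-- The orders of the first integrals in the second direction. -/
def firstIntegralOrders₂ (S : Set (ℤ → ℤ → ℂ)) : Set ℕ :=
  {l | ∃ w, IsFirstIntegral₂ S l w}

/-- Darboux integrability: there are first integrals in both directions. -/
def IsDarbouxIntegrable (S : Set (ℤ → ℤ → ℂ)) : Prop :=
  (∃ k w, IsFirstIntegral₁ S k w) ∧ (∃ l w, IsFirstIntegral₂ S l w)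

/-- The polynomial `(X - 1)(X + α^{N-1}) ⋯ (X + α)(X + 1)`, of degree `N + 1`. -/
noncomputable def burgersPoly₁ (N : ℕ) (α : ℂ) : Polynomial ℂ :=
  (Polynomial.X - 1) * ∏ j ∈ Finset.range N, (Polynomial.X + Polynomial.C (α ^ j))

/-- The polynomial `(X + α^n)(X - α^{n-N+1}) ⋯ (X - α^{n-1})`, of degree `N` (for `N ≥ 1`). -/
noncomputable def burgersPoly₂ (N : ℕ) (α : ℂ) (n : ℤ) : Polynomial ℂ :=
  (Polynomial.X + Polynomial.C (α ^ n)) *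
    ∏ j ∈ Finset.Ico 1 N, (Polynomial.X - Polynomial.C (α ^ (n - (j : ℤ))))

/-- With `∑ aᵢ Xⁱ = burgersPoly₁ N α`, the function
`α^{-m} (a₀ x₀ + a₁ x₀ x₁ + ⋯ + a_{N+1} x₀ ⋯ x_{N+1}) / (a₀ + a₁ x₀ + ⋯ + a_{N+1} x₀ ⋯ x_N)`. -/
noncomputable def burgersIntegral₁ (N : ℕ) (α : ℂ) (_n m : ℤ) (x : Fin (N + 1 + 1) → ℂ) : ℂ :=
  α ^ (-m) *
    ((∑ i : Fin (N + 1 + 1), (burgersPoly₁ N α).coeff i * ∏ r ∈ Finset.Iic i, x r) /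
     (∑ i : Fin (N + 1 + 1), (burgersPoly₁ N α).coeff i * ∏ r ∈ Finset.Iio i, x r))

/-- With `∑ bᵢ Xⁱ = burgersPoly₂ N α n` and `Zᵢ = αⁿ (xᵢ - 1) / (x_{i+1} + 1)`, the function
`(b₀ Z₀ + b₁ Z₀ Z₁ + ⋯ + b_N Z₀ ⋯ Z_N) / (b₀ + b₁ Z₀ + ⋯ + b_N Z₀ ⋯ Z_{N-1})`. -/
noncomputable def burgersIntegral₂ (N : ℕ) (α : ℂ) (n _m : ℤ) (x : Fin (N + 1 + 1) → ℂ) : ℂ :=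
  let Z : Fin (N + 1) → ℂ := fun i => α ^ n * ((x i.castSucc - 1) / (x i.succ + 1))
  (∑ i : Fin (N + 1), (burgersPoly₂ N α n).coeff i * ∏ r ∈ Finset.Iic i, Z r) /
    (∑ i : Fin (N + 1), (burgersPoly₂ N α n).coeff i * ∏ r ∈ Finset.Iio i, Z r)

open Polynomial Filter Topology

/-! The substitution u_{n,m} = v_{n+1,m} / v_{n,m} (discrete Hopf–Cole) produces solutions from the
linear equation v_{n+1,m+1} + v_{n,m+1} = α^n (v_{n+1,m} - v_{n,m}). Products of consecutive u are
ratios of values of v along a row. Also Z_{n,m} = v_{n,m+1} / v_{n,m}, so products of Z are ratios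
along a column. The numerators and denominators of W₁ and W₂ are therefore, up to a common factor,
linear difference operators applied to v.

Upper bound. With T the shift in n, the equation reads (T + 1) v_{·,m+1} = α^n (T - 1) v_{·,m}.
Moving a polynomial in T past α^n replaces T by αT. As α^N = -1, the roots of `burgersPoly₁` are
arranged so that this substitution closes up. With S the shift in m, the equation reads (S - α^n)
v_{n+1,·} = -(S + α^n) v_{n,·}, and the factors of `burgersPoly₂` telescope similarly. The direct
proofs (`rowRatio_eq`, `columnRatio_eq`) work with u alone, through moment functionals.

Lower bound. An integral of order k < N, written in homogeneous coordinates, gives functions W_s of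
k + 2 variables with W_{s+1}(q) = W_s(p) whenever q_{i+1} - β_{s+1} q_i = c (p_{i+1} + β_s p_i).
Differentiating along geometric progressions of ratio μ shows that dW_{s+1} annihilates ratio
β_{s+1}, and that it inherits every ratio μ ≠ -β_s annihilated by dW_s. Hence dW_s annihilates the
ratios β_s, β_{s-1}, …, β_{s-k-1}. These are distinct because α^N = -1 with N minimal, so
Vandermonde gives dW_s = 0 (`fderiv_eq_zero_of_chain`), against the dependence on the last variable.
-/

/-! ### Moment functionals -/

/-- The linear functional on polynomials sending `X ^ i` to `A i`. -/
noncomputable def momentFunctional (A : ℕ → ℂ) : ℂ[X] →ₗ[ℂ] ℂ :=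
  Polynomial.lsum fun i => A i • LinearMap.id

theorem momentFunctional_monomial (A : ℕ → ℂ) (i : ℕ) (c : ℂ) :
    momentFunctional A (monomial i c) = c * A i := by
  simp [momentFunctional, Polynomial.lsum_apply, mul_comm]

theorem momentFunctional_eq_sum_range (A : ℕ → ℂ) (p : ℂ[X]) (d : ℕ) (hd : p.natDegree < d) :
    momentFunctional A p = ∑ i ∈ Finset.range d, p.coeff i * A i := by
  conv_lhs => rw [p.as_sum_range' d hd]
  simp [momentFunctional_monomial]

theorem momentFunctional_X_mul (A : ℕ → ℂ) (p : ℂ[X]) :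
    momentFunctional A (X * p) = momentFunctional (fun i => A (i + 1)) p := by
  induction p using Polynomial.induction_on' with
  | add p q hp hq => rw [mul_add, map_add, map_add, hp, hq]
  | monomial i c => rw [X_mul_monomial, momentFunctional_monomial, momentFunctional_monomial]

/-- A three-term relation between two sequences passes to their moment functionals. -/
theorem momentFunctional_transfer {A B : ℕ → ℂ} {d : ℕ} {c₁ c₂ β β' γ : ℂ}
    (h : ∀ i ≤ d, c₁ * (B (i + 1) - β * B i) = c₂ * (γ ^ i * (A (i + 1) - β' * A i)))
    {q : ℂ[X]} (hq : q.natDegree ≤ d) :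
    c₁ * momentFunctional B ((X - C β) * q) =
      c₂ * momentFunctional A ((X - C β') * q.comp (C γ * X)) := by
  have hmon : ∀ i ≤ d, ∀ c : ℂ, c₁ * momentFunctional B ((X - C β) * monomial i c) =
      c₂ * momentFunctional A ((X - C β') * (monomial i c).comp (C γ * X)) := by
    intro i hi c
    have e : (monomial i c).comp (C γ * X) = monomial i (c * γ ^ i) := by
      rw [← C_mul_X_pow_eq_monomial, ← C_mul_X_pow_eq_monomial]
      simp [mul_pow, mul_assoc]
    rw [e, sub_mul, sub_mul, X_mul_monomial, X_mul_monomial, C_mul_monomial, C_mul_monomial,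
      map_sub, map_sub]
    simp only [momentFunctional_monomial]
    linear_combination c * h i hi
  rw [q.as_sum_range' (d + 1) (by omega), Polynomial.sum_comp, Finset.mul_sum,
    Finset.mul_sum, map_sum, map_sum, Finset.mul_sum, Finset.mul_sum]
  exact Finset.sum_congr rfl fun i hi => hmon i (by simp at hi; omega) _

theorem prod_Iio_fin_eq {n : ℕ} (a : ℕ → ℂ) (i : Fin n) :
    ∏ r ∈ Finset.Iio i, a r = ∏ r ∈ Finset.range i, a r := by
  have := Finset.prod_map (Finset.Iio i) Fin.valEmbedding a
  rw [Fin.map_valEmbedding_Iio, Nat.Iio_eq_range] at this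
  exact this.symm

theorem prod_Iic_fin_eq {n : ℕ} (a : ℕ → ℂ) (i : Fin n) :
    ∏ r ∈ Finset.Iic i, a r = ∏ r ∈ Finset.range (i + 1), a r := by
  have := Finset.prod_map (Finset.Iic i) Fin.valEmbedding a
  rw [Fin.map_valEmbedding_Iic] at this
  rw [show Finset.range ((i : ℕ) + 1) = Finset.Iic (i : ℕ) by ext; simp]
  exact this.symm

/-- The numerator `p₀ z₀ + p₁ z₀ z₁ + ⋯ + p_d z₀ ⋯ z_d`. -/
noncomputable def ratioNum {d : ℕ} (p : ℂ[X]) (z : Fin (d + 1) → ℂ) : ℂ :=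
  ∑ i : Fin (d + 1), p.coeff i * ∏ r ∈ Finset.Iic i, z r

/-- The denominator `p₀ + p₁ z₀ + ⋯ + p_d z₀ ⋯ z_{d-1}`. -/
noncomputable def ratioDen {d : ℕ} (p : ℂ[X]) (z : Fin (d + 1) → ℂ) : ℂ :=
  ∑ i : Fin (d + 1), p.coeff i * ∏ r ∈ Finset.Iio i, z r

theorem ratioDen_eq_momentFunctional {d : ℕ} {p : ℂ[X]} (hp : p.natDegree ≤ d) (a : ℕ → ℂ) :
    ratioDen (d := d) p (fun i => a i) =
      momentFunctional (fun i => ∏ r ∈ Finset.range i, a r) p := by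
  rw [momentFunctional_eq_sum_range _ p (d + 1) (by omega), ratioDen]
  simp only [prod_Iio_fin_eq]
  exact Fin.sum_univ_eq_sum_range (fun i => p.coeff i * ∏ r ∈ Finset.range i, a r) (d + 1)

theorem ratioNum_eq_momentFunctional {d : ℕ} {p : ℂ[X]} (hp : p.natDegree ≤ d) (a : ℕ → ℂ) :
    ratioNum (d := d) p (fun i => a i) =
      momentFunctional (fun i => ∏ r ∈ Finset.range i, a r) (X * p) := by
  rw [momentFunctional_X_mul, momentFunctional_eq_sum_range _ p (d + 1) (by omega), ratioNum]
  simp only [prod_Iic_fin_eq]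
  exact Fin.sum_univ_eq_sum_range (fun i => p.coeff i * ∏ r ∈ Finset.range (i + 1), a r) (d + 1)

/-! ### The polynomials behind the two integrals -/

theorem burgersIntegral₁_eq (N : ℕ) (α : ℂ) (n m : ℤ) (x : Fin (N + 1 + 1) → ℂ) :
    burgersIntegral₁ N α n m x =
      α ^ (-m) * (ratioNum (burgersPoly₁ N α) x / ratioDen (burgersPoly₁ N α) x) := rfl

/-- The variables `Zᵢ = αⁿ (xᵢ - 1) / (x_{i+1} + 1)`. -/
noncomputable def zTuple {N : ℕ} (α : ℂ) (n : ℤ) (x : Fin (N + 1 + 1) → ℂ) : Fin (N + 1) → ℂ :=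
  fun i => α ^ n * ((x i.castSucc - 1) / (x i.succ + 1))

theorem burgersIntegral₂_eq (N : ℕ) (α : ℂ) (n m : ℤ) (x : Fin (N + 1 + 1) → ℂ) :
    burgersIntegral₂ N α n m x =
      ratioNum (burgersPoly₂ N α n) (zTuple α n x) /
        ratioDen (burgersPoly₂ N α n) (zTuple α n x) := rfl

theorem burgersPoly₁_natDegree (N : ℕ) (α : ℂ) : (burgersPoly₁ N α).natDegree = N + 1 := by
  have h1 : (X - 1 : ℂ[X]).Monic := monic_X_sub_C (1 : ℂ)
  have h2 : ∀ j ∈ Finset.range N, (X + C (α ^ j) : ℂ[X]).Monic := fun j _ => monic_X_add_C _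
  rw [burgersPoly₁, h1.natDegree_mul (monic_prod_of_monic _ _ h2), natDegree_prod_of_monic _ _ h2,
    show (X - 1 : ℂ[X]).natDegree = 1 from natDegree_X_sub_C (1 : ℂ)]
  simp only [natDegree_X_add_C, Finset.sum_const, Finset.card_range, smul_eq_mul]
  omega

theorem burgersPoly₁_monic (N : ℕ) (α : ℂ) : (burgersPoly₁ N α).Monic :=
  (monic_X_sub_C (1 : ℂ)).mul (monic_prod_of_monic _ _ fun _ _ => monic_X_add_C _)

theorem burgersPoly₁_coeff_zero_ne (N : ℕ) {α : ℂ} (hα : α ≠ 0) :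
    (burgersPoly₁ N α).coeff 0 ≠ 0 := by
  rw [coeff_zero_eq_eval_zero, burgersPoly₁, eval_mul, eval_prod]
  simp [Finset.prod_eq_zero_iff, hα]

theorem burgersPoly₂_monic (N : ℕ) (α : ℂ) (n : ℤ) : (burgersPoly₂ N α n).Monic :=
  (monic_X_add_C _).mul (monic_prod_of_monic _ _ fun _ _ => monic_X_sub_C _)

theorem burgersPoly₂_natDegree {N : ℕ} (hN : 1 ≤ N) (α : ℂ) (n : ℤ) :
    (burgersPoly₂ N α n).natDegree = N := by
  have h2 : ∀ j ∈ Finset.Ico 1 N, (X - C (α ^ (n - (j : ℤ))) : ℂ[X]).Monic :=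
    fun j _ => monic_X_sub_C _
  rw [burgersPoly₂, (monic_X_add_C _).natDegree_mul (monic_prod_of_monic _ _ h2),
    natDegree_prod_of_monic _ _ h2]
  simp
  omega

theorem burgersPoly₂_coeff_zero_ne (N : ℕ) {α : ℂ} (hα : α ≠ 0) (n : ℤ) :
    (burgersPoly₂ N α n).coeff 0 ≠ 0 := by
  rw [coeff_zero_eq_eval_zero, burgersPoly₂, eval_mul, eval_prod]
  simp [Finset.prod_eq_zero_iff, hα, zpow_ne_zero]

/-- The quotient of `burgersPoly₁ N α` by `X + 1`. -/
noncomputable def burgersQuot₁ (N : ℕ) (α : ℂ) : ℂ[X] :=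
  (X - 1) * ∏ j ∈ Finset.Ico 1 N, (X + C (α ^ j))

theorem burgersQuot₁_natDegree {N : ℕ} (hN : 1 ≤ N) (α : ℂ) :
    (burgersQuot₁ N α).natDegree = N := by
  have h1 : (X - 1 : ℂ[X]).Monic := monic_X_sub_C (1 : ℂ)
  have h2 : ∀ j ∈ Finset.Ico 1 N, (X + C (α ^ j) : ℂ[X]).Monic := fun j _ => monic_X_add_C _
  rw [burgersQuot₁, h1.natDegree_mul (monic_prod_of_monic _ _ h2), natDegree_prod_of_monic _ _ h2,
    show (X - 1 : ℂ[X]).natDegree = 1 from natDegree_X_sub_C (1 : ℂ)]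
  simp only [natDegree_X_add_C, Finset.sum_const, Nat.card_Ico, smul_eq_mul]
  omega

theorem X_add_one_mul_burgersQuot₁ {N : ℕ} (hN : 1 ≤ N) (α : ℂ) :
    (X - C (-1)) * burgersQuot₁ N α = burgersPoly₁ N α := by
  rw [burgersQuot₁, burgersPoly₁, Finset.range_eq_Ico, Finset.prod_eq_prod_Ico_succ_bot hN]
  simp
  ring

/-- Substituting αX lowers each root exponent by one, up to scalars. The factor α^{N-1} collected
from the product turns αX - 1 into -(X + α^{N-1}), by α^N = -1, which supplies the factor missing at
the top. -/
theorem X_sub_one_mul_burgersQuot₁_comp {N : ℕ} (hN : 1 ≤ N) {α : ℂ} (hα : α ^ N = -1) :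
    (X - C 1) * (burgersQuot₁ N α).comp (C α * X) = - burgersPoly₁ N α := by
  obtain ⟨M, rfl⟩ := Nat.exists_eq_add_of_le' hN
  have hC : (C α * C (α ^ M) : ℂ[X]) = -1 := by rw [← C_mul, ← pow_succ', hα]; simp
  have h1 : ∏ j ∈ Finset.Ico 1 (M + 1), (X + C (α ^ j) : ℂ[X]).comp (C α * X) =
      C (α ^ M) * ∏ j ∈ Finset.range M, (X + C (α ^ j)) := by
    rw [Finset.prod_Ico_eq_prod_range]
    have : ∀ j ∈ Finset.range M, (X + C (α ^ (1 + j)) : ℂ[X]).comp (C α * X) =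
        C α * (X + C (α ^ j)) := by
      intro j _
      rw [pow_add]
      simp
      ring
    rw [Nat.add_sub_cancel, Finset.prod_congr rfl this, Finset.prod_mul_distrib]
    simp
  rw [burgersQuot₁, mul_comp, prod_comp, h1, burgersPoly₁, Finset.prod_range_succ]
  simp only [sub_comp, X_comp, one_comp, C_1]
  linear_combination ((X - 1) * (∏ j ∈ Finset.range M, (X + C (α ^ j))) * X
    + C (α ^ M) * (X - 1) * (∏ j ∈ Finset.range M, (X + C (α ^ j))) * 0) * hC

/-- Since α^{n+1} = -α^{n-(N-1)}, the exceptional factor X + α^{n+1} is the last factor of the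
product on the right. So the polynomials for n and n + 1 differ only by exchanging X + α^n for X -
α^n. -/
theorem burgersPoly₂_eq_prod_range {N : ℕ} (hN : 1 ≤ N) {α : ℂ} (hα : α ^ N = -1) (n : ℤ) :
    burgersPoly₂ N α (n + 1) =
      (X - C (α ^ n)) * ∏ j ∈ Finset.Ico 1 N, (X - C (α ^ (n - (j : ℤ)))) := by
  have h0 : α ≠ 0 := by rintro rfl; rw [zero_pow (by omega)] at hα; norm_num at hα
  obtain ⟨M, rfl⟩ := Nat.exists_eq_add_of_le' hN
  have h1 : (α : ℂ) ^ (n - (M : ℤ)) = - α ^ (n + 1) := by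
    have : α ^ (n + 1) = α ^ (n - (M : ℤ)) * α ^ (M + 1) := by
      rw [← zpow_natCast, ← zpow_add₀ h0]; congr 1; push_cast; ring
    rw [this, hα]; ring
  have h2 : (X - C (α ^ n)) * ∏ j ∈ Finset.Ico 1 (M + 1), (X - C (α ^ (n - (j : ℤ)))) =
      ∏ j ∈ Finset.range (M + 1), (X - C (α ^ (n - (j : ℤ)))) := by
    rw [Finset.range_eq_Ico, Finset.prod_eq_prod_Ico_succ_bot (Nat.succ_pos M)]
    simp
  rw [h2, Finset.prod_range_succ, h1, burgersPoly₂, Finset.prod_Ico_eq_prod_range, mul_comm]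
  congr 1
  · refine Finset.prod_congr rfl fun j _ => ?_
    congr 3
    push_cast; ring
  · simp

/-! ### Invariance of the moment ratios -/

/-- On a solution, the ratio of moments along two consecutive rows is multiplied by `α`. -/
theorem rowRatio_eq {N : ℕ} (hN : 1 ≤ N) {α : ℂ} (hα : α ^ N = -1) {a b : ℕ → ℂ}
    (heq : ∀ i, (b (i + 1) + 1) * (a i - 1) * b i = α * (b i + 1) * (a (i + 1) - 1) * a i)
    (ha : a 0 ≠ 1) (hb : ∀ i ≤ N + 1, b i ≠ -1) :
    ratioNum (d := N + 1) (burgersPoly₁ N α) (fun i => b i) /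
        ratioDen (d := N + 1) (burgersPoly₁ N α) (fun i => b i) =
      α * (ratioNum (d := N + 1) (burgersPoly₁ N α) (fun i => a i) /
        ratioDen (d := N + 1) (burgersPoly₁ N α) (fun i => a i)) := by
  have hdeg := (burgersPoly₁_natDegree N α).le
  rw [ratioNum_eq_momentFunctional hdeg, ratioNum_eq_momentFunctional hdeg,
    ratioDen_eq_momentFunctional hdeg, ratioDen_eq_momentFunctional hdeg]
  set A : ℕ → ℂ := fun i => ∏ r ∈ Finset.range i, a r with hA
  set B : ℕ → ℂ := fun i => ∏ r ∈ Finset.range i, b r with hB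
  have hAs : ∀ i, A (i + 1) = A i * a i := fun i => Finset.prod_range_succ _ _
  have hBs : ∀ i, B (i + 1) = B i * b i := fun i => Finset.prod_range_succ _ _
  have hb' : ∀ i ≤ N + 1, b i + 1 ≠ 0 := fun i hi h => hb i hi (eq_neg_of_add_eq_zero_left h)
  -- In Hopf–Cole terms `A i` = v_{n+i,m} / v_{n,m}, and `B i` is the same on row m + 1. This is the
  -- linear equation, with α^n v_{n,m} / v_{n,m+1} expressed as (b₀ + 1) / (a₀ - 1).
  have key : ∀ i ≤ N + 1, (a 0 - 1) * (B (i + 1) - (-1) * B i) =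
      (b 0 + 1) * (α ^ i * (A (i + 1) - 1 * A i)) := by
    intro i
    induction i with
    | zero => intro _; rw [hAs, hBs]; simp [hA, hB]; ring
    | succ i ih =>
      intro hi
      have ih := ih (by omega)
      refine mul_left_cancel₀ (hb' i (by omega)) ?_
      rw [hAs, hBs] at ih
      rw [hAs (i + 1), hBs (i + 1), hAs i, hBs i, pow_succ]
      linear_combination b i * (b (i + 1) + 1) * ih + (b 0 + 1) * α ^ i * A i * heq i
  have hQ := burgersQuot₁_natDegree hN α
  have e0 := momentFunctional_transfer key (q := burgersQuot₁ N α) (by omega)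
  -- The extra X becomes αX under the substitution, so the numerator picks up a factor α that the
  -- denominator does not.
  have e1 := momentFunctional_transfer key (q := X * burgersQuot₁ N α)
    (natDegree_mul_le.trans (by rw [hQ, natDegree_X]; omega))
  rw [X_add_one_mul_burgersQuot₁ hN, X_sub_one_mul_burgersQuot₁_comp hN hα, map_neg] at e0
  rw [mul_left_comm, X_add_one_mul_burgersQuot₁ hN, mul_comp, mul_left_comm,
    X_sub_one_mul_burgersQuot₁_comp hN hα, X_comp, mul_neg, mul_assoc, ← smul_eq_C_mul, map_neg,
    map_smul, smul_eq_mul] at e1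
  have hc1 : a 0 - 1 ≠ 0 := sub_ne_zero.2 ha
  have hc2 := hb' 0 (by omega)
  have r0 : momentFunctional B (burgersPoly₁ N α) =
      -((b 0 + 1) / (a 0 - 1)) * momentFunctional A (burgersPoly₁ N α) := by
    field_simp; linear_combination e0
  have r1 : momentFunctional B (X * burgersPoly₁ N α) =
      -((b 0 + 1) / (a 0 - 1)) * (α * momentFunctional A (X * burgersPoly₁ N α)) := by
    field_simp; linear_combination e1
  rw [r0, r1, mul_div_mul_left _ _ (neg_ne_zero.2 (div_ne_zero hc2 hc1)), mul_div_assoc]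

/-- On a solution, the ratio of moments is the same along two consecutive columns. -/
theorem columnRatio_eq {N : ℕ} (hN : 1 ≤ N) {α : ℂ} (hα : α ^ N = -1) (n : ℤ) {a b : ℕ → ℂ}
    (heq : ∀ i, (b (i + 1) + 1) * (a i - 1) * a (i + 1) =
      α * (a (i + 1) + 1) * (b i - 1) * a i)
    (ha : ∀ i ≤ N + 1, a i ≠ 0) (ha' : ∀ i ≤ N + 1, a i ≠ -1) (hb' : ∀ i ≤ N + 1, b i ≠ -1) :
    ratioNum (d := N) (burgersPoly₂ N α (n + 1)) (zTuple α (n + 1) fun i => b i) /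
        ratioDen (d := N) (burgersPoly₂ N α (n + 1)) (zTuple α (n + 1) fun i => b i) =
      ratioNum (d := N) (burgersPoly₂ N α n) (zTuple α n fun i => a i) /
        ratioDen (d := N) (burgersPoly₂ N α n) (zTuple α n fun i => a i) := by
  have h0 : α ≠ 0 := by rintro rfl; rw [zero_pow (by omega)] at hα; norm_num at hα
  set z : ℕ → ℂ := fun i => α ^ n * ((a i - 1) / (a (i + 1) + 1)) with hz
  set y : ℕ → ℂ := fun i => α ^ (n + 1) * ((b i - 1) / (b (i + 1) + 1)) with hy
  have ez : (zTuple α n fun i : Fin (N + 1 + 1) => a i) = fun i : Fin (N + 1) => z i := by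
    ext i; simp [zTuple, hz]
  have ey : (zTuple α (n + 1) fun i : Fin (N + 1 + 1) => b i) = fun i : Fin (N + 1) => y i := by
    ext i; simp [zTuple, hy]
  have hd := (burgersPoly₂_natDegree hN α n).le
  have hd' := (burgersPoly₂_natDegree hN α (n + 1)).le
  rw [ez, ey, ratioNum_eq_momentFunctional hd', ratioNum_eq_momentFunctional hd,
    ratioDen_eq_momentFunctional hd', ratioDen_eq_momentFunctional hd]
  set A : ℕ → ℂ := fun i => ∏ r ∈ Finset.range i, z r with hA
  set B : ℕ → ℂ := fun i => ∏ r ∈ Finset.range i, y r with hB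
  have hAs : ∀ i, A (i + 1) = A i * z i := fun i => Finset.prod_range_succ _ _
  have hBs : ∀ i, B (i + 1) = B i * y i := fun i => Finset.prod_range_succ _ _
  have hzi : ∀ i ≤ N, z i * (a (i + 1) + 1) = α ^ n * (a i - 1) := fun i hi => by
    have : a (i + 1) + 1 ≠ 0 := fun h => ha' _ (by omega) (eq_neg_of_add_eq_zero_left h)
    simp only [hz]; field_simp
  have hyi : ∀ i ≤ N, y i * a i = z i * a (i + 1) := fun i hi => by
    have h1 : a (i + 1) + 1 ≠ 0 := fun h => ha' _ (by omega) (eq_neg_of_add_eq_zero_left h)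
    have h2 : b (i + 1) + 1 ≠ 0 := fun h => hb' _ (by omega) (eq_neg_of_add_eq_zero_left h)
    simp only [hz, hy, zpow_add_one₀ h0]
    field_simp
    linear_combination - heq i
  -- Here `A i` and `B i` stand for v_{n,m+i} / v_{n,m} and v_{n+1,m+i} / v_{n+1,m}, and `a i` is
  -- the quotient of the two columns at height m + i.
  have hAB : ∀ i ≤ N + 1, a 0 * B i = A i * a i := by
    intro i
    induction i with
    | zero => intro _; simp [hA, hB]
    | succ i ih =>
      intro hi
      rw [hBs, hAs, ← mul_assoc, ih (by omega)]
      linear_combination A i * hyi i (by omega)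
  have key : ∀ i ≤ N, a 0 * (B (i + 1) - α ^ n * B i) =
      (-1) * (1 ^ i * (A (i + 1) - (-α ^ n) * A i)) := by
    intro i hi
    have e1 := hAB i (by omega)
    have e2 := hAB (i + 1) (by omega)
    rw [hAs i] at e2 ⊢
    linear_combination e2 - α ^ n * e1 + A i * hzi i hi
  set Q : ℂ[X] := ∏ j ∈ Finset.Ico 1 N, (X - C (α ^ (n - (j : ℤ)))) with hQ
  have hQd : Q.natDegree = N - 1 := by
    rw [hQ, natDegree_prod_of_monic _ _ fun j _ => monic_X_sub_C _]; simp
  have e0 := momentFunctional_transfer key (q := Q) (by omega)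
  have e1 := momentFunctional_transfer key (q := X * Q)
    (natDegree_mul_le.trans (by rw [hQd, natDegree_X]; omega))
  have hP : (X - C (-α ^ n)) * Q = burgersPoly₂ N α n := by simp [burgersPoly₂, hQ]
  simp only [C_1, one_mul, comp_X] at e0 e1
  rw [hP, ← burgersPoly₂_eq_prod_range hN hα] at e0
  rw [mul_left_comm, mul_left_comm (X - C (-α ^ n)), hP, ← burgersPoly₂_eq_prod_range hN hα] at e1
  have hc := ha 0 (by omega)
  have r0 : momentFunctional B (burgersPoly₂ N α (n + 1)) =
      (-1 / a 0) * momentFunctional A (burgersPoly₂ N α n) := by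
    field_simp; linear_combination e0
  have r1 : momentFunctional B (X * burgersPoly₂ N α (n + 1)) =
      (-1 / a 0) * momentFunctional A (X * burgersPoly₂ N α n) := by
    field_simp; linear_combination e1
  rw [r0, r1, mul_div_mul_left _ _ (div_ne_zero (by norm_num) hc)]

/-! ### Nondegeneracy in the extreme variables and dense domains -/

theorem ratioNum_update_zero {d : ℕ} (p : ℂ[X]) (z : Fin (d + 1) → ℂ) :
    ∃ R : ℂ, ∀ s, ratioNum p (Function.update z 0 s) = s * R := by
  refine ⟨∑ i : Fin (d + 1), p.coeff i * ∏ r ∈ Finset.Iic i \ {0}, z r, fun s => ?_⟩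
  rw [ratioNum, Finset.mul_sum]
  refine Finset.sum_congr rfl fun i _ => ?_
  rw [Finset.prod_update_of_mem (by simp)]
  ring

theorem ratioDen_update_zero {d : ℕ} (p : ℂ[X]) (z : Fin (d + 1) → ℂ) :
    ∃ R : ℂ, ∀ s, ratioDen p (Function.update z 0 s) = p.coeff 0 + s * R := by
  refine ⟨∑ i : Fin d, p.coeff i.succ * ∏ r ∈ Finset.Iio i.succ \ {0}, z r, fun s => ?_⟩
  rw [ratioDen, Fin.sum_univ_succ, Finset.mul_sum]
  congr 1
  · rw [Finset.prod_eq_one fun r hr => absurd (Finset.mem_Iio.1 hr) (Fin.not_lt_zero r)]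
    simp
  · refine Finset.sum_congr rfl fun i _ => ?_
    rw [Finset.prod_update_of_mem (by simp)]
    ring

theorem ratioNum_update_last {d : ℕ} (p : ℂ[X]) (z : Fin (d + 1) → ℂ) :
    ∃ c : ℂ, ∀ s, ratioNum p (Function.update z (Fin.last d) s) =
      c + s * (p.coeff d * ∏ r ∈ Finset.Iic (Fin.last d) \ {Fin.last d}, z r) := by
  refine ⟨∑ i : Fin d, p.coeff i * ∏ r ∈ Finset.Iic i.castSucc, z r, fun s => ?_⟩
  rw [ratioNum, Fin.sum_univ_castSucc]
  congr 1
  · refine Finset.sum_congr rfl fun i _ => ?_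
    rw [Finset.prod_update_of_notMem (by simp)]
    simp
  · rw [Finset.prod_update_of_mem (by simp), Fin.val_last]
    ring

theorem ratioDen_update_last {d : ℕ} (p : ℂ[X]) (z : Fin (d + 1) → ℂ) (s : ℂ) :
    ratioDen p (Function.update z (Fin.last d) s) = ratioDen p z := by
  refine Finset.sum_congr rfl fun i _ => ?_
  rw [Finset.prod_update_of_notMem (by simp [Fin.le_last])]

/-- In the first variable the ratio is sR / (p₀ + sR'), with derivative R p₀ / (p₀ + sR')². A
nonzero numerator forces R ≠ 0. -/
theorem hasDerivAt_ratio_update_zero {d : ℕ} {p : ℂ[X]} (hp : p.coeff 0 ≠ 0)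
    {z : Fin (d + 1) → ℂ} (hn : ratioNum p z ≠ 0) (hd : ratioDen p z ≠ 0) :
    ∃ D : ℂ, D ≠ 0 ∧ HasDerivAt
      (fun s => ratioNum p (Function.update z 0 s) / ratioDen p (Function.update z 0 s)) D (z 0) := by
  obtain ⟨R, hR⟩ := ratioNum_update_zero p z
  obtain ⟨R', hR'⟩ := ratioDen_update_zero p z
  have e1 := hR (z 0)
  have e2 := hR' (z 0)
  rw [Function.update_eq_self] at e1 e2
  have h0 : R ≠ 0 := by rintro rfl; exact hn (by rw [e1, mul_zero])
  rw [e2] at hd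
  simp only [hR, hR']
  have h1 : HasDerivAt (fun s : ℂ => s * R) (1 * R) (z 0) := (hasDerivAt_id' _).mul_const R
  have h2 : HasDerivAt (fun s : ℂ => p.coeff 0 + s * R') (1 * R') (z 0) :=
    ((hasDerivAt_id' _).mul_const R').const_add _
  refine ⟨_, ?_, h1.div h2 hd⟩
  refine div_ne_zero ?_ (pow_ne_zero 2 hd)
  have : 1 * R * (p.coeff 0 + z 0 * R') - z 0 * R * (1 * R') = R * p.coeff 0 := by ring
  rw [this]
  exact mul_ne_zero h0 hp

/-- Only the top term of the numerator contains the last variable, so the ratio is affine in it. -/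
theorem hasDerivAt_ratio_update_last {d : ℕ} {p : ℂ[X]} (hp : p.coeff d ≠ 0)
    {z : Fin (d + 1) → ℂ} (hz : ∀ i, z i ≠ 0) (hd : ratioDen p z ≠ 0) :
    ∃ D : ℂ, D ≠ 0 ∧ HasDerivAt
      (fun s => ratioNum p (Function.update z (Fin.last d) s) /
        ratioDen p (Function.update z (Fin.last d) s)) D (z (Fin.last d)) := by
  obtain ⟨c, hc⟩ := ratioNum_update_last p z
  simp only [hc, ratioDen_update_last]
  refine ⟨_, ?_, (((hasDerivAt_id' _).mul_const _).const_add c).div_const _⟩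
  exact div_ne_zero (mul_ne_zero one_ne_zero (mul_ne_zero hp
    (Finset.prod_ne_zero_iff.2 fun i _ => hz i))) hd

theorem fderiv_single_ne_zero {k : ℕ} {w : (Fin k → ℂ) → ℂ} {x : Fin k → ℂ} {i : Fin k} {D : ℂ}
    (hw : DifferentiableAt ℂ w x) (hD : D ≠ 0)
    (h : HasDerivAt (fun t => w (Function.update x i t)) D (x i)) :
    fderiv ℂ w x (Pi.single i 1) ≠ 0 := by
  have hw' : HasFDerivAt w (fderiv ℂ w x) (Function.update x i (x i)) := by
    rw [Function.update_eq_self]; exact hw.hasFDerivAt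
  have := hw'.comp_hasDerivAt (x i) (hasDerivAt_update x i (x i))
  rw [this.unique h]
  exact hD

theorem ratioNum_analyticAt {d : ℕ} (p : ℂ[X]) (z : Fin (d + 1) → ℂ) :
    AnalyticAt ℂ (ratioNum p) z := by
  have hproj : ∀ r : Fin (d + 1), AnalyticAt ℂ (fun z : Fin (d + 1) → ℂ => z r) z := fun r =>
    (ContinuousLinearMap.proj (R := ℂ) (φ := fun _ : Fin (d + 1) => ℂ) r).analyticAt z
  exact Finset.analyticAt_fun_sum _ fun i _ =>
    analyticAt_const.mul (Finset.analyticAt_fun_prod _ fun r _ => hproj r)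

theorem ratioDen_analyticAt {d : ℕ} (p : ℂ[X]) (z : Fin (d + 1) → ℂ) :
    AnalyticAt ℂ (ratioDen p) z := by
  have hproj : ∀ r : Fin (d + 1), AnalyticAt ℂ (fun z : Fin (d + 1) → ℂ => z r) z := fun r =>
    (ContinuousLinearMap.proj (R := ℂ) (φ := fun _ : Fin (d + 1) => ℂ) r).analyticAt z
  exact Finset.analyticAt_fun_sum _ fun i _ =>
    analyticAt_const.mul (Finset.analyticAt_fun_prod _ fun r _ => hproj r)

theorem zTuple_analyticAt {N : ℕ} (α : ℂ) (n : ℤ) {x : Fin (N + 1 + 1) → ℂ}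
    (hx : ∀ i, x i ≠ -1) : AnalyticAt ℂ (zTuple (N := N) α n) x := by
  have hproj : ∀ r : Fin (N + 1 + 1), AnalyticAt ℂ (fun z : Fin (N + 1 + 1) → ℂ => z r) x :=
    fun r => (ContinuousLinearMap.proj (R := ℂ) (φ := fun _ : Fin (N + 1 + 1) => ℂ) r).analyticAt x
  refine analyticAt_pi_iff.2 fun i => analyticAt_const.mul
    (((hproj _).sub analyticAt_const).div ((hproj _).add analyticAt_const) fun h => ?_)
  exact hx i.succ (eq_neg_of_add_eq_zero_left h)

theorem zTuple_ne_zero {N : ℕ} {α : ℂ} (hα : α ≠ 0) (n : ℤ) {x : Fin (N + 1 + 1) → ℂ}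
    (hx : ∀ i, x i ≠ 1) (hx' : ∀ i, x i ≠ -1) (i : Fin (N + 1)) : zTuple α n x i ≠ 0 :=
  mul_ne_zero (zpow_ne_zero _ hα) (div_ne_zero (sub_ne_zero.2 (hx _))
    fun h => hx' _ (eq_neg_of_add_eq_zero_left h))

theorem zTuple_update_zero {N : ℕ} (α : ℂ) (n : ℤ) (x : Fin (N + 1 + 1) → ℂ) (t : ℂ) :
    zTuple α n (Function.update x 0 t) =
      Function.update (zTuple α n x) 0 (α ^ n * ((t - 1) / (x 1 + 1))) := by
  ext i
  rcases eq_or_ne i 0 with rfl | hi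
  · simp [zTuple]
  · simp [zTuple, Function.update_of_ne hi,
      Function.update_of_ne (Fin.castSucc_ne_zero_iff.2 hi)]

theorem zTuple_update_last {N : ℕ} (α : ℂ) (n : ℤ) (x : Fin (N + 1 + 1) → ℂ) (t : ℂ) :
    zTuple α n (Function.update x (Fin.last _) t) =
      Function.update (zTuple α n x) (Fin.last _)
        (α ^ n * ((x (Fin.last N).castSucc - 1) / (t + 1))) := by
  ext i
  rcases eq_or_ne i (Fin.last N) with rfl | hi
  · simp [zTuple]
  · have h : i.succ ≠ Fin.last (N + 1) := by rwa [← Fin.succ_last, Ne, Fin.succ_inj]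
    simp [zTuple, Function.update_of_ne hi, Function.update_of_ne h]

/-- The tuples none of whose entries is `0`, `1` or `-1`. -/
def regularTuples (k : ℕ) : Set (Fin k → ℂ) := Set.pi Set.univ fun _ => {0, 1, -1}ᶜ

theorem mem_regularTuples {k : ℕ} {x : Fin k → ℂ} :
    x ∈ regularTuples k ↔ ∀ i, x i ≠ 0 ∧ x i ≠ 1 ∧ x i ≠ -1 := by
  simp [regularTuples]

theorem isOpen_regularTuples (k : ℕ) : IsOpen (regularTuples k) :=
  isOpen_set_pi Set.finite_univ fun _ _ => (Set.toFinite _).isClosed.isOpen_compl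

theorem dense_regularTuples (k : ℕ) : Dense (regularTuples k) :=
  dense_pi _ fun _ _ => (Set.toFinite ({0, 1, -1} : Set ℂ)).countable.dense_compl ℂ

/-- If on every coordinate line through a point of `U` in a suitable direction `f` has at most one
zero, then `f` is nonzero on a dense subset of `U`. -/
theorem dense_inter_ne_zero {k : ℕ} {U : Set (Fin k → ℂ)} (hUo : IsOpen U) (hU : Dense U)
    {f : (Fin k → ℂ) → ℂ} (h : ∀ x ∈ U, ∃ i s, ∀ t, Function.update x i t ∈ U →
      f (Function.update x i t) = 0 → t = s) : Dense (U ∩ {x | f x ≠ 0}) := by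
  rw [dense_iff_inter_open]
  intro O hO hne
  obtain ⟨x, hxO, hxU⟩ := hU.inter_open_nonempty O hO hne
  obtain ⟨i, s, hs⟩ := h x hxU
  have hc : Continuous fun t : ℂ => Function.update x i t := by fun_prop
  obtain ⟨t, ht, hts⟩ := (dense_compl_singleton s).inter_open_nonempty _
    ((hO.inter hUo).preimage hc) ⟨x i, by simp [hxO, hxU]⟩
  exact ⟨_, ht.1, ht.2, fun h0 => hts (hs t ht.2 h0)⟩

theorem isOpen_inter_ne_zero {k : ℕ} {U : Set (Fin k → ℂ)} (hUo : IsOpen U)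
    {f : (Fin k → ℂ) → ℂ} (h : ∀ x ∈ U, ContinuousAt f x) : IsOpen (U ∩ {x | f x ≠ 0}) :=
  ContinuousOn.isOpen_inter_preimage (fun x hx => (h x hx).continuousWithinAt) hUo
    isOpen_compl_singleton

/-- A family given by the same kind of formula for all `n, m`, on domains with the pointwise
nondegeneracy properties, has order `k`. -/
theorem isFamilyOfOrder_of_forall {k : ℕ} (hk : 1 ≤ k) {w : ℤ → ℤ → (Fin (k + 1) → ℂ) → ℂ}
    {f g : ℤ → ℤ → (Fin (k + 1) → ℂ) → ℂ}
    (hf : ∀ n m, ∀ x ∈ regularTuples (k + 1), ContinuousAt (f n m) x)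
    (hg : ∀ n m, ∀ x ∈ regularTuples (k + 1), ContinuousAt (g n m) x)
    (hf' : ∀ n m, ∀ x ∈ regularTuples (k + 1), ∃ i s, ∀ t,
      Function.update x i t ∈ regularTuples (k + 1) → f n m (Function.update x i t) = 0 → t = s)
    (hg' : ∀ n m, ∀ x ∈ regularTuples (k + 1), ∃ i s, ∀ t,
      Function.update x i t ∈ regularTuples (k + 1) → g n m (Function.update x i t) = 0 → t = s)
    (hw : ∀ n m, ∀ x ∈ regularTuples (k + 1), f n m x ≠ 0 → g n m x ≠ 0 → AnalyticAt ℂ (w n m) x)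
    (h0 : ∀ n m, ∀ x ∈ regularTuples (k + 1), f n m x ≠ 0 → g n m x ≠ 0 → ∃ D : ℂ, D ≠ 0 ∧
      HasDerivAt (fun t => w n m (Function.update x 0 t)) D (x 0))
    (h1 : ∀ n m, ∀ x ∈ regularTuples (k + 1), f n m x ≠ 0 → g n m x ≠ 0 → ∃ D : ℂ, D ≠ 0 ∧
      HasDerivAt (fun t => w n m (Function.update x (Fin.last k) t)) D (x (Fin.last k))) :
    IsFamilyOfOrder k w fun n m =>
      (regularTuples (k + 1) ∩ {x | f n m x ≠ 0}) ∩ (regularTuples (k + 1) ∩ {x | g n m x ≠ 0}) := by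
  have ho := isOpen_regularTuples (k + 1)
  have hd := dense_regularTuples (k + 1)
  have hdense : ∀ n m, Dense ((regularTuples (k + 1) ∩ {x | f n m x ≠ 0}) ∩
      (regularTuples (k + 1) ∩ {x | g n m x ≠ 0})) := fun n m =>
    (dense_inter_ne_zero ho hd (hf' n m)).inter_of_isOpen_left
      (dense_inter_ne_zero ho hd (hg' n m)) (isOpen_inter_ne_zero ho (hf n m))
  obtain ⟨x, ⟨hx, hxf⟩, -, hxg⟩ := (hdense 0 0).nonempty
  refine ⟨hk, fun n m => (isOpen_inter_ne_zero ho (hf n m)).inter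
    (isOpen_inter_ne_zero ho (hg n m)), hdense,
    fun n m x hx => hw n m x hx.1.1 hx.1.2 hx.2.2, ⟨0, 0, x, ⟨⟨hx, hxf⟩, hx, hxg⟩, ?_⟩,
    ⟨0, 0, x, ⟨⟨hx, hxf⟩, hx, hxg⟩, ?_⟩⟩
  · obtain ⟨D, hD, h⟩ := h0 0 0 x hx hxf hxg
    exact fderiv_single_ne_zero (hw 0 0 x hx hxf hxg).differentiableAt hD h
  · obtain ⟨D, hD, h⟩ := h1 0 0 x hx hxf hxg
    exact fderiv_single_ne_zero (hw 0 0 x hx hxf hxg).differentiableAt hD h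

theorem eq_of_add_mul_eq_zero {c e t : ℂ} (he : e ≠ 0) (h : c + t * e = 0) : t = -c / e := by
  field_simp
  linear_combination h

/-! ### The explicit first integrals -/

theorem isFirstIntegral₁_burgersIntegral₁ {N : ℕ} (hN : 1 ≤ N) {α : ℂ} (hα : α ^ N = -1) :
    IsFirstIntegral₁ (burgersSolutions α) (N + 1) (burgersIntegral₁ N α) := by
  have h0 : α ≠ 0 := by rintro rfl; rw [zero_pow (by omega)] at hα; norm_num at hα
  have hp0 := burgersPoly₁_coeff_zero_ne N h0
  have hpl : (burgersPoly₁ N α).coeff (N + 1) ≠ 0 := by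
    have := (burgersPoly₁_monic N α).coeff_natDegree
    rw [burgersPoly₁_natDegree] at this
    rw [this]; exact one_ne_zero
  refine ⟨_, isFamilyOfOrder_of_forall (by omega)
    (f := fun _ _ => ratioNum (burgersPoly₁ N α)) (g := fun _ _ => ratioDen (burgersPoly₁ N α))
    (fun _ _ x _ => (ratioNum_analyticAt _ x).continuousAt)
    (fun _ _ x _ => (ratioDen_analyticAt _ x).continuousAt) ?_ ?_ ?_ ?_ ?_, ?_⟩
  · intro n m x hx
    rw [mem_regularTuples] at hx
    obtain ⟨c, hc⟩ := ratioNum_update_last (burgersPoly₁ N α) x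
    set e := (burgersPoly₁ N α).coeff (N + 1) *
      ∏ r ∈ Finset.Iic (Fin.last (N + 1)) \ {Fin.last (N + 1)}, x r
    have he : e ≠ 0 := mul_ne_zero hpl (Finset.prod_ne_zero_iff.2 fun i _ => (hx i).1)
    refine ⟨Fin.last _, -c / e, fun t _ ht => ?_⟩
    rw [hc] at ht
    exact eq_of_add_mul_eq_zero he ht
  · intro n m x hx
    obtain ⟨R, hR⟩ := ratioDen_update_zero (burgersPoly₁ N α) x
    -- If R = 0, the denominator is the nonzero constant p₀ on this line and has no zero, so the
    -- value of the witness is then irrelevant.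
    refine ⟨0, -(burgersPoly₁ N α).coeff 0 / R, fun t _ ht => ?_⟩
    rw [hR] at ht
    exact eq_of_add_mul_eq_zero (by rintro rfl; simp [hp0] at ht) ht
  · intro n m x _ _ hg
    exact analyticAt_const.mul ((ratioNum_analyticAt _ x).div (ratioDen_analyticAt _ x) hg)
  · intro n m x _ hf hg
    obtain ⟨D, hD, h⟩ := hasDerivAt_ratio_update_zero hp0 hf hg
    exact ⟨_, mul_ne_zero (zpow_ne_zero (-m) h0) hD, h.const_mul _⟩
  · intro n m x hx _ hg
    rw [mem_regularTuples] at hx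
    obtain ⟨D, hD, h⟩ := hasDerivAt_ratio_update_last hpl (fun i => (hx i).1) hg
    exact ⟨_, mul_ne_zero (zpow_ne_zero (-m) h0) hD, h.const_mul _⟩
  · intro u hu n m hD hD'
    have r1 := mem_regularTuples.1 hD.1.1
    have r2 := mem_regularTuples.1 hD'.1.1
    have key := rowRatio_eq hN hα (a := fun i => u (n + i) m) (b := fun i => u (n + i) (m + 1))
      (fun i => by simpa [add_assoc] using hu (n + i) m)
      (by simpa [rowTuple] using (r1 0).2.1)
      (fun i hi => by simpa [rowTuple] using (r2 ⟨i, by omega⟩).2.2)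
    rw [burgersIntegral₁_eq, burgersIntegral₁_eq]
    unfold rowTuple
    rw [key, neg_add, zpow_add₀ h0, zpow_neg_one]
    field_simp

theorem isFirstIntegral₂_burgersIntegral₂ {N : ℕ} (hN : 1 ≤ N) {α : ℂ} (hα : α ^ N = -1) :
    IsFirstIntegral₂ (burgersSolutions α) (N + 1) (burgersIntegral₂ N α) := by
  have h0 : α ≠ 0 := by rintro rfl; rw [zero_pow (by omega)] at hα; norm_num at hα
  have hp0 := fun n => burgersPoly₂_coeff_zero_ne N h0 n
  have hpl : ∀ n, (burgersPoly₂ N α n).coeff N ≠ 0 := by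
    intro n
    have := (burgersPoly₂_monic N α n).coeff_natDegree
    rw [burgersPoly₂_natDegree hN] at this
    rw [this]; exact one_ne_zero
  have hadd : ∀ {c : ℂ}, c ≠ -1 → c + 1 ≠ 0 := fun hc h => hc (eq_neg_of_add_eq_zero_left h)
  refine ⟨_, isFamilyOfOrder_of_forall (by omega)
    (f := fun n _ x => ratioNum (burgersPoly₂ N α n) (zTuple α n x))
    (g := fun n _ x => ratioDen (burgersPoly₂ N α n) (zTuple α n x)) ?_ ?_ ?_ ?_ ?_ ?_ ?_, ?_⟩
  · intro n _ x hx
    have hz := zTuple_analyticAt (N := N) α n fun i => ((mem_regularTuples.1 hx) i).2.2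
    exact ((ratioNum_analyticAt _ _).comp hz).continuousAt
  · intro n _ x hx
    have hz := zTuple_analyticAt (N := N) α n fun i => ((mem_regularTuples.1 hx) i).2.2
    exact ((ratioDen_analyticAt _ _).comp hz).continuousAt
  · intro n m x hx
    rw [mem_regularTuples] at hx
    obtain ⟨c, hc⟩ := ratioNum_update_last (burgersPoly₂ N α n) (zTuple α n x)
    set e := (burgersPoly₂ N α n).coeff N *
      ∏ r ∈ Finset.Iic (Fin.last N) \ {Fin.last N}, zTuple α n x r with he
    have he0 : e ≠ 0 := mul_ne_zero (hpl n) (Finset.prod_ne_zero_iff.2 fun i _ =>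
      zTuple_ne_zero h0 n (fun i => (hx i).2.1) (fun i => (hx i).2.2) i)
    set y := α ^ n * (x (Fin.last N).castSucc - 1) with hy
    have hy0 : y ≠ 0 := mul_ne_zero (zpow_ne_zero _ h0) (sub_ne_zero.2 (hx _).2.1)
    -- Clearing the denominator t + 1 in c + (y / (t + 1)) e = 0 leaves c (t + 1) + y e = 0. For c =
    -- 0 this has no solution, as y e ≠ 0.
    refine ⟨Fin.last _, -(c + y * e) / c, fun t ht h => ?_⟩
    have ht' : t + 1 ≠ 0 := hadd (by simpa using (mem_regularTuples.1 ht (Fin.last _)).2.2)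
    rw [zTuple_update_last, hc, ← mul_div_assoc, ← hy] at h
    have h2 : c * (t + 1) + y * e = 0 := by field_simp at h; linear_combination h
    refine eq_of_add_mul_eq_zero ?_ (by linear_combination h2)
    rintro rfl
    exact mul_ne_zero hy0 he0 (by linear_combination h2)
  · intro n m x hx
    rw [mem_regularTuples] at hx
    obtain ⟨R, hR⟩ := ratioDen_update_zero (burgersPoly₂ N α n) (zTuple α n x)
    have hx1 := hadd (hx 1).2.2
    set e := α ^ n * R / (x 1 + 1) with he
    refine ⟨0, -((burgersPoly₂ N α n).coeff 0 - e) / e, fun t _ ht => ?_⟩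
    rw [zTuple_update_zero, hR] at ht
    have ht' : (burgersPoly₂ N α n).coeff 0 - e + t * e = 0 := by
      rw [he]; field_simp; field_simp at ht; linear_combination ht
    refine eq_of_add_mul_eq_zero ?_ ht'
    intro h; rw [h] at ht'; simp [hp0] at ht'
  · intro n m x hx _ hg
    have hz := zTuple_analyticAt (N := N) α n fun i => ((mem_regularTuples.1 hx) i).2.2
    exact ((ratioNum_analyticAt _ _).comp hz).div ((ratioDen_analyticAt _ _).comp hz) hg
  · intro n m x hx hf hg
    rw [mem_regularTuples] at hx
    obtain ⟨D, hD, h⟩ := hasDerivAt_ratio_update_zero (hp0 n) hf hg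
    have hζ : HasDerivAt (fun t : ℂ => α ^ n * ((t - 1) / (x 1 + 1))) (α ^ n * (1 / (x 1 + 1)))
      (x 0) := (((hasDerivAt_id' _).sub_const 1).div_const _).const_mul _
    refine ⟨_, mul_ne_zero hD (mul_ne_zero (zpow_ne_zero n h0)
      (one_div_ne_zero (hadd (hx 1).2.2))), ?_⟩
    simp only [burgersIntegral₂_eq, zTuple_update_zero]
    exact HasDerivAt.comp (x 0) (h₂ := fun s => ratioNum (burgersPoly₂ N α n)
      (Function.update (zTuple α n x) 0 s) / ratioDen (burgersPoly₂ N α n)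
      (Function.update (zTuple α n x) 0 s)) h hζ
  · intro n m x hx hf hg
    rw [mem_regularTuples] at hx
    obtain ⟨D, hD, h⟩ := hasDerivAt_ratio_update_last (hpl n)
      (zTuple_ne_zero h0 n (fun i => (hx i).2.1) (fun i => (hx i).2.2)) hg
    set y := x (Fin.last N).castSucc - 1 with hy
    have hy0 : y ≠ 0 := sub_ne_zero.2 (hx _).2.1
    have hl := hadd (hx (Fin.last (N + 1))).2.2
    have hs : HasDerivAt (fun t : ℂ => t + 1) 1 (x (Fin.last (N + 1))) :=
      (hasDerivAt_id' _).add_const 1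
    have hζ : HasDerivAt (fun t : ℂ => α ^ n * (y / (t + 1)))
        (α ^ n * ((0 * (x (Fin.last (N + 1)) + 1) - y * 1) / (x (Fin.last (N + 1)) + 1) ^ 2))
        (x (Fin.last (N + 1))) :=
      ((hasDerivAt_const _ y).div hs hl).const_mul _
    have hne : 0 * (x (Fin.last (N + 1)) + 1) - y * 1 ≠ 0 := by simpa using hy0
    refine ⟨_, mul_ne_zero hD (mul_ne_zero (zpow_ne_zero n h0)
      (div_ne_zero hne (pow_ne_zero 2 hl))), ?_⟩
    simp only [burgersIntegral₂_eq, zTuple_update_last]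
    exact HasDerivAt.comp (x (Fin.last (N + 1))) (h₂ := fun s => ratioNum (burgersPoly₂ N α n)
      (Function.update (zTuple α n x) (Fin.last N) s) / ratioDen (burgersPoly₂ N α n)
      (Function.update (zTuple α n x) (Fin.last N) s)) h hζ
  · intro u hu n m hD hD'
    have r1 := mem_regularTuples.1 hD.1.1
    have r2 := mem_regularTuples.1 hD'.1.1
    exact columnRatio_eq hN hα n (a := fun i => u n (m + i)) (b := fun i => u (n + 1) (m + i))
      (fun i => by simpa [add_assoc] using hu n (m + i))
      (fun i hi => by simpa [colTuple] using (r1 ⟨i, by omega⟩).1)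
      (fun i hi => by simpa [colTuple] using (r1 ⟨i, by omega⟩).2.2)
      (fun i hi => by simpa [colTuple] using (r2 ⟨i, by omega⟩).2.2)

/-! ### The linear lattice equation and the Hopf–Cole transformation -/

/-- A relation that can be solved in both directions admits two-sided chains. -/
theorem exists_int_chain {T : Type*} (F : ℤ → T → T → Prop) (hup : ∀ n x, ∃ y, F n x y)
    (hdown : ∀ n y, ∃ x, F n x y) (a : ℤ) (x₀ : T) :
    ∃ s : ℤ → T, s a = x₀ ∧ ∀ n, F n (s n) (s (n + 1)) := by
  choose up hup using hup
  choose down hdown using hdown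
  let P : ℕ → T := fun k => Nat.rec x₀ (fun j x => up (a + j) x) k
  let M : ℕ → T := fun k => Nat.rec x₀ (fun j x => down (a - (j + 1)) x) k
  have hP : ∀ j : ℕ, P (j + 1) = up (a + j) (P j) := fun _ => rfl
  have hM : ∀ j : ℕ, M (j + 1) = down (a - (j + 1)) (M j) := fun _ => rfl
  let s : ℤ → T := fun n => if a ≤ n then P (n - a).toNat else M (a - n).toNat
  have sP : ∀ j : ℕ, s (a + j) = P j := fun j => by simp [s]
  have sM : ∀ j : ℕ, s (a - j) = M j := by
    rintro (_ | j)
    · simp [s, P, M]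
    · have : ¬ a ≤ a - ((j + 1 : ℕ) : ℤ) := by push_cast; omega
      have e : (a - (a - ((j + 1 : ℕ) : ℤ))).toNat = j + 1 := by omega
      simp only [s, this, if_false, e]
  refine ⟨s, by simpa [P] using sP 0, fun n => ?_⟩
  rcases le_or_gt a n with h | h
  · obtain ⟨j, rfl⟩ := Int.le.dest h
    rw [sP, show a + (j : ℤ) + 1 = a + ((j + 1 : ℕ) : ℤ) by push_cast; ring, sP, hP]
    exact hup _ _
  · obtain ⟨j, hj⟩ := Int.le.dest (show n + 1 ≤ a by omega)
    obtain rfl : n = a - ((j + 1 : ℕ) : ℤ) := by push_cast; omega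
    rw [sM, show a - ((j + 1 : ℕ) : ℤ) + 1 = a - (j : ℤ) by push_cast; ring, sM, hM]
    push_cast
    exact hdown _ _

/-- The solutions of the linear lattice equation to which the discrete Hopf-Cole transformation
reduces the Burgers-type equation. -/
def linearSolutions (α : ℂ) : Submodule ℂ (ℤ → ℤ → ℂ) where
  carrier := {v | ∀ n m : ℤ, v (n + 1) (m + 1) + v n (m + 1) = α ^ n * (v (n + 1) m - v n m)}
  add_mem' := fun {v w} hv hw n m => by
    simp only [Pi.add_apply]; linear_combination hv n m + hw n m
  zero_mem' := fun n m => by simp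
  smul_mem' := fun c v hv n m => by
    simp only [Pi.smul_apply, smul_eq_mul]; linear_combination c * hv n m

theorem mem_linearSolutions {α : ℂ} {v : ℤ → ℤ → ℂ} : v ∈ linearSolutions α ↔
    ∀ n m : ℤ, v (n + 1) (m + 1) + v n (m + 1) = α ^ n * (v (n + 1) m - v n m) := Iff.rfl

theorem isClosed_linearSolutions (α : ℂ) : IsClosed (linearSolutions α : Set (ℤ → ℤ → ℂ)) := by
  have : (linearSolutions α : Set (ℤ → ℤ → ℂ)) = ⋂ n : ℤ, ⋂ m : ℤ,
      {v | v (n + 1) (m + 1) + v n (m + 1) = α ^ n * (v (n + 1) m - v n m)} := by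
    ext v; simp [mem_linearSolutions]
  rw [this]
  refine isClosed_iInter fun n => isClosed_iInter fun m => isClosed_eq ?_ ?_ <;> fun_prop

/-- The linear equation has a solution with arbitrary values on one row and one column. -/
theorem exists_linearSolution {α : ℂ} (hα : α ≠ 0) (n₀ m₀ : ℤ) (row col : ℤ → ℂ)
    (h : row n₀ = col m₀) :
    ∃ v ∈ linearSolutions α, (∀ n, v n m₀ = row n) ∧ ∀ m, v n₀ m = col m := by
  have hc : ∀ n : ℤ, α ^ n ≠ 0 := fun n => zpow_ne_zero n hα
  -- The column is prescribed through the conserved defect f n₀ - col m rather than by f n₀ = col m,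
  -- so that each step is solvable from an arbitrary row. The defect is zero on the initial row.
  obtain ⟨s, hs0, hs⟩ := exists_int_chain (T := ℤ → ℂ)
    (fun m f g => (∀ n, g (n + 1) + g n = α ^ n * (f (n + 1) - f n)) ∧
      g n₀ - col (m + 1) = f n₀ - col m)
    (fun m f => by
      obtain ⟨g, hg0, hg⟩ := exists_int_chain (fun n x y => y + x = α ^ n * (f (n + 1) - f n))
        (fun n x => ⟨α ^ n * (f (n + 1) - f n) - x, by ring⟩)
        (fun n y => ⟨α ^ n * (f (n + 1) - f n) - y, by ring⟩) n₀ (col (m + 1) + (f n₀ - col m))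
      exact ⟨g, hg, by rw [hg0]; ring⟩)
    (fun m g => by
      obtain ⟨f, hf0, hf⟩ := exists_int_chain (fun n x y => g (n + 1) + g n = α ^ n * (y - x))
        (fun n x => ⟨(g (n + 1) + g n) / α ^ n + x, by have := hc n; field_simp; ring⟩)
        (fun n y => ⟨y - (g (n + 1) + g n) / α ^ n, by have := hc n; field_simp; ring⟩)
        n₀ (col m + (g n₀ - col (m + 1)))
      exact ⟨f, hf, by rw [hf0]; ring⟩)
    m₀ row
  refine ⟨fun n m => s m n, fun n m => (hs m).1 n, fun n => congrFun hs0 n, fun m => ?_⟩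
  have : ∀ m, s m n₀ - col m = 0 := by
    intro m
    induction m using Int.inductionOn' (b := m₀) with
    | zero => rw [hs0, h, sub_self]
    | succ k _ ih => rw [(hs k).2, ih]
    | pred k _ ih => rw [← (hs (k - 1)).2, sub_add_cancel, ih]
  exact sub_eq_zero.1 (this m)

/-- Baire category in the closed subspace of solutions: each evaluation is a nonzero continuous
functional, hence open, so its nonvanishing set is open and dense, and there are countably many
lattice points. This provides genuine solutions u near any v. -/
theorem dense_linearSolutions_ne_zero {α : ℂ} (hα : α ≠ 0) :
    Dense {v : linearSolutions α | ∀ n m, v.1 n m ≠ 0} := by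
  have : TopologicalSpace.IsCompletelyPseudoMetrizableSpace (linearSolutions α) :=
    (isClosed_linearSolutions α).isClosedEmbedding_subtypeVal.IsCompletelyPseudoMetrizableSpace
  let ev : ℤ × ℤ → linearSolutions α →L[ℂ] ℂ := fun p =>
    ((ContinuousLinearMap.proj (R := ℂ) (φ := fun _ : ℤ => ℂ) p.2).comp
      (ContinuousLinearMap.proj (R := ℂ) (φ := fun _ : ℤ => ℤ → ℂ) p.1)).comp
      (linearSolutions α).subtypeL
  have hev : ∀ p (v : linearSolutions α), ev p v = v.1 p.1 p.2 := fun _ _ => rfl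
  have hne : ∀ p, ev p ≠ 0 := by
    intro p hp
    obtain ⟨v, hv, hr, -⟩ := exists_linearSolution hα p.1 p.2 (fun _ => 1) (fun _ => 1) rfl
    have := (hev p ⟨v, hv⟩).trans (hr p.1)
    rw [hp] at this
    simp at this
  have := dense_iInter_of_isOpen (f := fun p => ev p ⁻¹' {0}ᶜ)
    (fun p => isOpen_compl_singleton.preimage (ev p).continuous)
    (fun p => (dense_compl_singleton (0 : ℂ)).preimage ((ev p).isOpenMap_of_ne_zero (hne p)))
  refine this.mono fun v hv n m => ?_
  exact Set.mem_iInter.1 hv (n, m)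

/-- The discrete Hopf-Cole transformation. -/
noncomputable def hopfCole (v : ℤ → ℤ → ℂ) (n m : ℤ) : ℂ := v (n + 1) m / v n m

theorem hopfCole_mem_burgersSolutions {α : ℂ} (hα : α ≠ 0) {v : ℤ → ℤ → ℂ}
    (hv : v ∈ linearSolutions α) (h0 : ∀ n m, v n m ≠ 0) : hopfCole v ∈ burgersSolutions α := by
  intro n m
  have e1 := hv n m
  have e2 := hv (n + 1) m
  rw [zpow_add_one₀ hα] at e2
  have h1 := h0 n m
  have h2 := h0 (n + 1) m
  have h3 := h0 n (m + 1)
  have h4 := h0 (n + 1) (m + 1)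
  simp only [hopfCole]
  field_simp
  linear_combination (v (n + 1) m - v n m) * e2 - α * (v (n + 1 + 1) m - v (n + 1) m) * e1

/-- A relation between two functions that are continuous at `x₀`, valid near `x₀` on a dense set,
holds at `x₀`. -/
theorem eq_of_dense_of_eventually {E T : Type*} [TopologicalSpace E] [TopologicalSpace T]
    [T2Space T] {s : Set E} (hs : Dense s) {F G : E → T} {x₀ : E} (hF : ContinuousAt F x₀) (hG : ContinuousAt G x₀)
    (h : ∀ᶠ x in 𝓝 x₀, x ∈ s → F x = G x) : F x₀ = G x₀ := by
  have : (𝓝[s] x₀).NeBot := mem_closure_iff_nhdsWithin_neBot.1 (hs x₀)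
  refine tendsto_nhds_unique_of_eventuallyEq (l := 𝓝[s] x₀) (hF.tendsto.mono_left nhdsWithin_le_nhds)
    (hG.tendsto.mono_left nhdsWithin_le_nhds) ?_
  exact eventually_nhdsWithin_iff.2 h

theorem continuousAt_hopfCole {α : ℂ} {n m : ℤ} {v : linearSolutions α} (h : v.1 n m ≠ 0) :
    ContinuousAt (fun v : linearSolutions α => hopfCole v.1 n m) v := by
  have hc : ∀ n m, Continuous fun v : linearSolutions α => v.1 n m := fun n m =>
    (continuous_apply m).comp ((continuous_apply n).comp continuous_subtype_val)
  exact (hc _ _).continuousAt.div (hc _ _).continuousAt h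

/-- A first integral in the first direction is preserved by solutions of the linear equation even
if these vanish somewhere else. -/
theorem row_eq_of_linearSolution {α : ℂ} (hα : α ≠ 0) {k : ℕ}
    {w : ℤ → ℤ → (Fin (k + 1) → ℂ) → ℂ} {D : ℤ → ℤ → Set (Fin (k + 1) → ℂ)}
    (hD : IsFamilyOfOrder k w D)
    (hw : ∀ u ∈ burgersSolutions α, ∀ n m : ℤ, rowTuple u k n m ∈ D n m →
      rowTuple u k n (m + 1) ∈ D n (m + 1) →
      w n (m + 1) (rowTuple u k n (m + 1)) = w n m (rowTuple u k n m))
    {v : ℤ → ℤ → ℂ} (hv : v ∈ linearSolutions α) {n m : ℤ}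
    (h0 : ∀ i : Fin (k + 1), v (n + (i : ℕ)) m ≠ 0)
    (h1 : ∀ i : Fin (k + 1), v (n + (i : ℕ)) (m + 1) ≠ 0)
    (hm : rowTuple (hopfCole v) k n m ∈ D n m)
    (hm' : rowTuple (hopfCole v) k n (m + 1) ∈ D n (m + 1)) :
    w n (m + 1) (rowTuple (hopfCole v) k n (m + 1)) = w n m (rowTuple (hopfCole v) k n m) := by
  have c0 : ContinuousAt (fun v : linearSolutions α => rowTuple (hopfCole v.1) k n m) ⟨v, hv⟩ :=
    continuousAt_pi.2 fun i => continuousAt_hopfCole (h0 i)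
  have c1 : ContinuousAt (fun v : linearSolutions α => rowTuple (hopfCole v.1) k n (m + 1))
    ⟨v, hv⟩ := continuousAt_pi.2 fun i => continuousAt_hopfCole (h1 i)
  refine eq_of_dense_of_eventually (dense_linearSolutions_ne_zero hα) (x₀ := ⟨v, hv⟩)
    (F := fun v => w n (m + 1) (rowTuple (hopfCole v.1) k n (m + 1)))
    (G := fun v => w n m (rowTuple (hopfCole v.1) k n m))
    (ContinuousAt.comp (hD.holomorphic n (m + 1) _ hm').continuousAt c1)
    (ContinuousAt.comp (hD.holomorphic n m _ hm).continuousAt c0) ?_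
  filter_upwards [c0.eventually ((hD.isOpen n m).mem_nhds hm),
    c1.eventually ((hD.isOpen n (m + 1)).mem_nhds hm')] with x hx hx' hx0
  exact hw _ (hopfCole_mem_burgersSolutions hα x.2 hx0) n m hx hx'

/-- A first integral in the second direction is preserved by solutions of the linear equation even
if these vanish somewhere else. -/
theorem col_eq_of_linearSolution {α : ℂ} (hα : α ≠ 0) {l : ℕ}
    {w : ℤ → ℤ → (Fin (l + 1) → ℂ) → ℂ} {D : ℤ → ℤ → Set (Fin (l + 1) → ℂ)}
    (hD : IsFamilyOfOrder l w D)
    (hw : ∀ u ∈ burgersSolutions α, ∀ n m : ℤ, colTuple u l n m ∈ D n m →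
      colTuple u l (n + 1) m ∈ D (n + 1) m →
      w (n + 1) m (colTuple u l (n + 1) m) = w n m (colTuple u l n m))
    {v : ℤ → ℤ → ℂ} (hv : v ∈ linearSolutions α) {n m : ℤ}
    (h0 : ∀ i : Fin (l + 1), v n (m + (i : ℕ)) ≠ 0)
    (h1 : ∀ i : Fin (l + 1), v (n + 1) (m + (i : ℕ)) ≠ 0)
    (hm : colTuple (hopfCole v) l n m ∈ D n m)
    (hm' : colTuple (hopfCole v) l (n + 1) m ∈ D (n + 1) m) :
    w (n + 1) m (colTuple (hopfCole v) l (n + 1) m) = w n m (colTuple (hopfCole v) l n m) := by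
  have c0 : ContinuousAt (fun v : linearSolutions α => colTuple (hopfCole v.1) l n m) ⟨v, hv⟩ :=
    continuousAt_pi.2 fun i => continuousAt_hopfCole (h0 i)
  have c1 : ContinuousAt (fun v : linearSolutions α => colTuple (hopfCole v.1) l (n + 1) m)
    ⟨v, hv⟩ := continuousAt_pi.2 fun i => continuousAt_hopfCole (h1 i)
  refine eq_of_dense_of_eventually (dense_linearSolutions_ne_zero hα) (x₀ := ⟨v, hv⟩)
    (F := fun v => w (n + 1) m (colTuple (hopfCole v.1) l (n + 1) m))
    (G := fun v => w n m (colTuple (hopfCole v.1) l n m))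
    (ContinuousAt.comp (hD.holomorphic (n + 1) m _ hm').continuousAt c1)
    (ContinuousAt.comp (hD.holomorphic n m _ hm).continuousAt c0) ?_
  filter_upwards [c0.eventually ((hD.isOpen n m).mem_nhds hm),
    c1.eventually ((hD.isOpen (n + 1) m).mem_nhds hm')] with x hx hx' hx0
  exact hw _ (hopfCole_mem_burgersSolutions hα x.2 hx0) n m hx hx'

/-! ### Vanishing derivatives along chains of related tuples -/

/-- The relation between two tuples `p`, `q` given by the first-order difference operators
`q ↦ q_{i+1} - b q_i` and `p ↦ c (p_{i+1} + a p_i)`. -/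
def shiftRelation (k : ℕ) (a b c : ℂ) :
    Submodule ℂ ((Fin (k + 2) → ℂ) × (Fin (k + 2) → ℂ)) where
  carrier := {r | ∀ i : Fin (k + 1),
    r.2 i.succ - b * r.2 i.castSucc = c * (r.1 i.succ + a * r.1 i.castSucc)}
  add_mem' := fun {r r'} h h' i => by
    simp only [Prod.fst_add, Prod.snd_add, Pi.add_apply]; linear_combination h i + h' i
  zero_mem' := fun i => by simp
  smul_mem' := fun t r h i => by
    simp only [Prod.smul_fst, Prod.smul_snd, Pi.smul_apply, smul_eq_mul]
    linear_combination t * h i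

theorem mem_shiftRelation {k : ℕ} {a b c : ℂ} {p q : Fin (k + 2) → ℂ} :
    (p, q) ∈ shiftRelation k a b c ↔ ∀ i : Fin (k + 1),
      q i.succ - b * q i.castSucc = c * (p i.succ + a * p i.castSucc) := Iff.rfl

theorem exists_first_order_recurrence {n : ℕ} (b : ℂ) (h : Fin n → ℂ) :
    ∃ q : Fin (n + 1) → ℂ, ∀ i, q i.succ = b * q i.castSucc + h i :=
  ⟨fun j => Fin.induction (motive := fun _ => ℂ) 0 (fun i x => b * x + h i) j,
    fun i => Fin.induction_succ _ _ i⟩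

/-- For dense open sets of tuples, the second components of the pairs related by `shiftRelation`
whose components lie in these sets are dense. -/
theorem dense_snd_shiftRelation {k : ℕ} {a b c : ℂ} (hc : c ≠ 0) {Ω Ω' : Set (Fin (k + 2) → ℂ)}
    (hΩ : Dense Ω) (hΩo : IsOpen Ω) (hΩ' : Dense Ω') :
    Dense {q | ∃ p, (p, q) ∈ shiftRelation k a b c ∧ p ∈ Ω ∧ q ∈ Ω'} := by
  let π₁ : shiftRelation k a b c →ₗ[ℂ] (Fin (k + 2) → ℂ) :=
    (LinearMap.fst ℂ _ _).comp (shiftRelation k a b c).subtype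
  let π₂ : shiftRelation k a b c →ₗ[ℂ] (Fin (k + 2) → ℂ) :=
    (LinearMap.snd ℂ _ _).comp (shiftRelation k a b c).subtype
  have s₁ : Function.Surjective π₁ := fun p => by
    obtain ⟨q, hq⟩ := exists_first_order_recurrence b
      fun i : Fin (k + 1) => c * (p i.succ + a * p i.castSucc)
    exact ⟨⟨(p, q), fun i => by simp only [hq]; ring⟩, rfl⟩
  have s₂ : Function.Surjective π₂ := fun q => by
    obtain ⟨p, hp⟩ := exists_first_order_recurrence (-a)
      fun i : Fin (k + 1) => (q i.succ - b * q i.castSucc) / c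
    exact ⟨⟨(p, q), fun i => by simp only [hp]; field_simp; ring⟩, rfl⟩
  have c₁ : Continuous π₁ := π₁.continuous_of_finiteDimensional
  have c₂ : Continuous π₂ := π₂.continuous_of_finiteDimensional
  -- Both projections of the relation are surjective linear maps between finite-dimensional spaces,
  -- hence open, and preimages of dense sets under open maps are dense.
  have d : Dense (π₁ ⁻¹' Ω ∩ π₂ ⁻¹' Ω') :=
    (hΩ.preimage (π₁.isOpenMap_of_finiteDimensional s₁)).inter_of_isOpen_left
      (hΩ'.preimage (π₂.isOpenMap_of_finiteDimensional s₂)) (hΩo.preimage c₁)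
  refine (s₂.denseRange.dense_image c₂ d).mono ?_
  rintro _ ⟨r, ⟨h1, h2⟩, rfl⟩
  exact ⟨π₁ r, r.2, h1, h2⟩

/-- If two functions agree on related pairs, so do their derivatives in related directions. -/
theorem fderiv_eq_of_related {E : Type*} [NormedAddCommGroup E] [NormedSpace ℂ E]
    {R : Submodule ℂ (E × E)} {Ω Ω' : Set E} (hΩ : IsOpen Ω) (hΩ' : IsOpen Ω') {W W' : E → ℂ}
    (h : ∀ p q, (p, q) ∈ R → p ∈ Ω → q ∈ Ω' → W' q = W p) {p q φ γ : E} (hp : p ∈ Ω)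
    (hq : q ∈ Ω') (hW : DifferentiableAt ℂ W p) (hW' : DifferentiableAt ℂ W' q)
    (hpq : (p, q) ∈ R) (hφ : (φ, γ) ∈ R) : fderiv ℂ W' q γ = fderiv ℂ W p φ := by
  have d1 : HasDerivAt (fun t : ℂ => W (p + t • φ)) (fderiv ℂ W p φ) 0 :=
    hW.hasFDerivAt.hasLineDerivAt φ
  have d2 : HasDerivAt (fun t : ℂ => W' (q + t • γ)) (fderiv ℂ W' q γ) 0 :=
    hW'.hasFDerivAt.hasLineDerivAt γ
  have line : ∀ x v : E, ∀ O : Set E, IsOpen O → x ∈ O → ∀ᶠ t : ℂ in 𝓝 0, x + t • v ∈ O := by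
    intro x v O hO hx
    have hcont : Continuous fun t : ℂ => x + t • v := by fun_prop
    exact hcont.continuousAt.eventually (hO.mem_nhds (by simpa using hx))
  refine d2.unique (d1.congr_of_eventuallyEq ?_)
  filter_upwards [line p φ Ω hΩ hp, line q γ Ω' hΩ' hq] with t h1 h2
  exact h _ _ (R.add_mem hpq (R.smul_mem t hφ)) h1 h2

theorem geom_mem_shiftRelation {k : ℕ} {a b c μ x y : ℂ} (h : y * (μ - b) = c * (x * (μ + a))) :
    ((x • fun i : Fin (k + 2) => μ ^ (i : ℕ)), (y • fun i : Fin (k + 2) => μ ^ (i : ℕ))) ∈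
      shiftRelation k a b c := by
  intro i
  simp only [Pi.smul_apply, smul_eq_mul, Fin.val_succ, Fin.val_castSucc, pow_succ]
  linear_combination μ ^ (i : ℕ) * h

/-- Differentiating along the related directions (xμ^i, yμ^i) gives y dW'(q)(μ^i) = x dW(p)(μ^i) =
0. This covers only those q that have a partner p in Ω; they are dense, and continuity of the
derivative does the rest. -/
theorem fderiv_geom_transfer {k : ℕ} {a b c : ℂ} (hc : c ≠ 0) {Ω Ω' : Set (Fin (k + 2) → ℂ)}
    (hΩ : IsOpen Ω) (hΩd : Dense Ω) (hΩ' : IsOpen Ω') (hΩd' : Dense Ω')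
    {W W' : (Fin (k + 2) → ℂ) → ℂ} (hW : AnalyticOnNhd ℂ W Ω) (hW' : AnalyticOnNhd ℂ W' Ω')
    (h : ∀ p q, (p, q) ∈ shiftRelation k a b c → p ∈ Ω → q ∈ Ω' → W' q = W p) {μ x y : ℂ}
    (hy : y ≠ 0) (hxy : y * (μ - b) = c * (x * (μ + a)))
    (hx : ∀ p ∈ Ω, x * fderiv ℂ W p (fun i => μ ^ (i : ℕ)) = 0) :
    ∀ q ∈ Ω', fderiv ℂ W' q (fun i => μ ^ (i : ℕ)) = 0 := by
  intro q hq
  have hcont : ContinuousAt (fun q => fderiv ℂ W' q (fun i => μ ^ (i : ℕ))) q :=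
    ((hW'.fderiv q hq).continuousAt).clm_apply continuousAt_const
  refine eq_of_dense_of_eventually (dense_snd_shiftRelation (a := a) (b := b) hc hΩd hΩ hΩd')
    hcont (continuousAt_const (y := (0 : ℂ))) (Eventually.of_forall ?_)
  rintro q' ⟨p, hpq, hp, hq'⟩
  have := fderiv_eq_of_related hΩ hΩ' h hp hq' (hW p hp).differentiableAt
    (hW' q' hq').differentiableAt hpq (geom_mem_shiftRelation hxy)
  rw [map_smul, map_smul, smul_eq_mul, smul_eq_mul, hx p hp] at this
  exact (mul_eq_zero.1 this).resolve_left hy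

/-- Vandermonde: geometric progressions with n distinct ratios span the n-tuples. -/
theorem eq_zero_of_forall_geom {n : ℕ} (L : (Fin n → ℂ) →L[ℂ] ℂ) {f : Fin n → ℂ}
    (hf : Function.Injective f) (h : ∀ j, L (fun i => f j ^ (i : ℕ)) = 0) : L = 0 := by
  have expand : ∀ x, L x = ∑ i, x i * L (fun j => if i = j then 1 else 0) := fun x =>
    LinearMap.pi_apply_eq_sum_univ (L : (Fin n → ℂ) →ₗ[ℂ] ℂ) x
  have := Matrix.eq_zero_of_forall_index_sum_pow_mul_eq_zero (f := f)
    (v := fun i => L (fun j => if i = j then 1 else 0)) hf (fun j => by rw [← expand, h])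
  ext1 x
  rw [expand]
  simp [fun i => congrFun this i]

/-- A sequence of functions that agree along chains of related tuples has zero derivatives. -/
theorem fderiv_eq_zero_of_chain {k : ℕ} {β : ℤ → ℂ} {c : ℂ} (hc : c ≠ 0)
    (hβ : ∀ s, ∀ t : ℕ, t < k + 1 → β s ≠ -β (s + t))
    (hβ' : ∀ s, Function.Injective fun j : Fin (k + 2) => β (s - (j : ℕ)))
    {Ω : ℤ → Set (Fin (k + 2) → ℂ)} (hΩ : ∀ s, IsOpen (Ω s)) (hΩd : ∀ s, Dense (Ω s))
    {W : ℤ → (Fin (k + 2) → ℂ) → ℂ} (hW : ∀ s, AnalyticOnNhd ℂ (W s) (Ω s))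
    (h : ∀ s p q, (p, q) ∈ shiftRelation k (β s) (β (s + 1)) c → p ∈ Ω s → q ∈ Ω (s + 1) →
      W (s + 1) q = W s p) : ∀ s, ∀ p ∈ Ω s, fderiv ℂ (W s) p = 0 := by
  have key : ∀ j : ℕ, j ≤ k + 1 → ∀ s, ∀ p ∈ Ω s,
      fderiv ℂ (W s) p (fun i => β (s - j) ^ (i : ℕ)) = 0 := by
    intro j
    induction j with
    | zero =>
      intro _ s
      obtain ⟨s, rfl⟩ : ∃ r, s = r + 1 := ⟨s - 1, by ring⟩
      -- For μ = β (s + 1) the operator on q kills the progression, so q may move along it while p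
      -- stays fixed.
      exact fderiv_geom_transfer hc (hΩ s) (hΩd s) (hΩ _) (hΩd _) (hW s) (hW _) (h s)
        (x := 0) (y := 1) one_ne_zero (by simp) (by simp)
    | succ j ih =>
      intro hj s
      obtain ⟨s, rfl⟩ : ∃ r, s = r + 1 := ⟨s - 1, by ring⟩
      have e : s + 1 - ((j + 1 : ℕ) : ℤ) = s - j := by push_cast; ring
      rw [e]
      -- These x and y solve y (μ - β (s + 1)) = c x (μ + β s) for μ = β (s - j), and y ≠ 0 is
      -- exactly the non-antipodality hypothesis on β.
      refine fderiv_geom_transfer hc (hΩ s) (hΩd s) (hΩ _) (hΩd _) (hW s) (hW _) (h s)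
        (x := β (s - j) - β (s + 1)) (y := c * (β (s - j) + β s)) ?_ (by ring) ?_
      · refine mul_ne_zero hc fun h0 => hβ (s - j) j (by omega) ?_
        rw [sub_add_cancel]
        exact eq_neg_of_add_eq_zero_left h0
      · intro p hp
        rw [ih (by omega) s p hp, mul_zero]
  exact fun s p hp => eq_zero_of_forall_geom _ (hβ' s) fun j => key j (by omega) s p hp

/-! ### From homogeneous coordinates to the original variables -/

/-- If a map has local sections through all points of a dense set, preimages of dense sets are
dense. -/
theorem dense_inter_preimage_of_section {E F : Type*} [TopologicalSpace E] [TopologicalSpace F]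
    {U : Set E} (hUo : IsOpen U) (hU : Dense U) {D : Set F} (hD : Dense D) {r : E → F}
    (h : ∀ p ∈ U, ∃ σ : F → E, ContinuousAt σ (r p) ∧ σ (r p) = p ∧
      ∀ᶠ x in 𝓝 (r p), r (σ x) = x) : Dense (U ∩ r ⁻¹' D) := by
  rw [dense_iff_inter_open]
  intro O hO hne
  obtain ⟨p, hpO, hpU⟩ := hU.inter_open_nonempty O hO hne
  obtain ⟨σ, hσ, hσp, hr⟩ := h p hpU
  have hmem : ∀ᶠ x in 𝓝 (r p), σ x ∈ O ∩ U :=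
    hσ.eventually ((hO.inter hUo).mem_nhds (by rw [hσp]; exact ⟨hpO, hpU⟩))
  obtain ⟨x, hxD, hx, hrx⟩ :=
    ((mem_closure_iff_frequently.1 (hD (r p))).and_eventually (hmem.and hr)).exists
  exact ⟨σ x, hx.1, hx.2, by rwa [Set.mem_preimage, hrx]⟩

/-- Near x, w equals (w ∘ r) ∘ σ, so the chain rule applies. -/
theorem fderiv_eq_zero_of_section {E F : Type*} [NormedAddCommGroup E] [NormedSpace ℂ E]
    [NormedAddCommGroup F] [NormedSpace ℂ F] {w : F → ℂ} {r : E → F} {σ : F → E} {x : F}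
    (hσ : DifferentiableAt ℂ σ x) (hr : ∀ᶠ y in 𝓝 x, r (σ y) = y)
    (hw : DifferentiableAt ℂ (w ∘ r) (σ x)) (h0 : fderiv ℂ (w ∘ r) (σ x) = 0) :
    fderiv ℂ w x = 0 := by
  have e : w =ᶠ[𝓝 x] (w ∘ r) ∘ σ := by
    filter_upwards [hr] with y hy
    simp [hy]
  rw [e.fderiv_eq, fderiv_comp x hw hσ, h0, ContinuousLinearMap.zero_comp]

/-- The ratios of consecutive entries of a tuple. -/
noncomputable def ratioTuple {k : ℕ} (p : Fin (k + 2) → ℂ) : Fin (k + 1) → ℂ :=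
  fun i => p i.succ / p i.castSucc

theorem differentiable_partialProd {n : ℕ} :
    Differentiable ℂ fun t : Fin n → ℂ => Fin.partialProd t := by
  refine differentiable_pi.2 fun i => ?_
  induction i using Fin.induction with
  | zero => simp
  | succ i ih =>
    simp only [Fin.partialProd_succ]
    exact ih.mul (differentiable_apply i)

theorem partialProd_ne_zero {n : ℕ} {t : Fin n → ℂ} (ht : ∀ i, t i ≠ 0) (i : Fin (n + 1)) :
    Fin.partialProd t i ≠ 0 := by
  induction i using Fin.induction with
  | zero => simp
  | succ i ih => rw [Fin.partialProd_succ]; exact mul_ne_zero ih (ht i)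

theorem ratioTuple_smul_partialProd {k : ℕ} {t : Fin (k + 1) → ℂ} (ht : ∀ i, t i ≠ 0) {a : ℂ}
    (ha : a ≠ 0) : ratioTuple (a • Fin.partialProd t) = t := by
  ext i
  have := partialProd_ne_zero ht i.castSucc
  simp only [ratioTuple, Pi.smul_apply, smul_eq_mul, Fin.partialProd_succ]
  field_simp

theorem smul_partialProd_ratioTuple {k : ℕ} {p : Fin (k + 2) → ℂ} (hp : ∀ i, p i ≠ 0) :
    p 0 • Fin.partialProd (ratioTuple p) = p := by
  ext i
  induction i using Fin.induction with
  | zero => simp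
  | succ i ih =>
    simp only [Pi.smul_apply, smul_eq_mul, Fin.partialProd_succ] at ih ⊢
    rw [← mul_assoc, ih, ratioTuple, mul_div_cancel₀ _ (hp _)]

theorem analyticAt_ratioTuple {k : ℕ} {p : Fin (k + 2) → ℂ} (hp : ∀ i, p i ≠ 0) :
    AnalyticAt ℂ (ratioTuple (k := k)) p := by
  have hproj : ∀ r : Fin (k + 2), AnalyticAt ℂ (fun z : Fin (k + 2) → ℂ => z r) p := fun r =>
    (ContinuousLinearMap.proj (R := ℂ) (φ := fun _ : Fin (k + 2) => ℂ) r).analyticAt p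
  exact analyticAt_pi_iff.2 fun i => (hproj _).div (hproj _) (hp _)

theorem isOpen_setOf_forall_mem {n : ℕ} {A : Set ℂ} (hA : IsOpen A) :
    IsOpen {t : Fin n → ℂ | ∀ i, t i ∈ A} := by
  simpa [Set.pi] using isOpen_set_pi (s := fun _ : Fin n => A) Set.finite_univ fun _ _ => hA

theorem dense_setOf_forall_mem {n : ℕ} {A : Set ℂ} (hA : Dense A) :
    Dense {t : Fin n → ℂ | ∀ i, t i ∈ A} := by
  simpa [Set.pi] using dense_pi (Set.univ : Set (Fin n)) (s := fun _ : Fin n => A) fun _ _ => hA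

/-- The chain lemma is applied to w ∘ `ratioTuple` on tuples without zero entries. Partial products
are sections of `ratioTuple`; they give density of the pulled-back domains and bring the vanishing
derivative back to w. -/
theorem fderiv_eq_zero_of_ratio_chain {k : ℕ} {β : ℤ → ℂ} {c : ℂ} (hc : c ≠ 0)
    (hβ : ∀ s, ∀ t : ℕ, t < k + 1 → β s ≠ -β (s + t))
    (hβ' : ∀ s, Function.Injective fun j : Fin (k + 2) => β (s - (j : ℕ)))
    {D : ℤ → Set (Fin (k + 1) → ℂ)} (hD : ∀ s, IsOpen (D s)) (hDd : ∀ s, Dense (D s))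
    (hD0 : ∀ s, ∀ t ∈ D s, ∀ i, t i ≠ 0)
    {w : ℤ → (Fin (k + 1) → ℂ) → ℂ} (hw : ∀ s, AnalyticOnNhd ℂ (w s) (D s))
    (h : ∀ s p q, (p, q) ∈ shiftRelation k (β s) (β (s + 1)) c → (∀ i, p i ≠ 0) →
      (∀ i, q i ≠ 0) → ratioTuple p ∈ D s → ratioTuple q ∈ D (s + 1) →
      w (s + 1) (ratioTuple q) = w s (ratioTuple p)) : ∀ s, ∀ t ∈ D s, fderiv ℂ (w s) t = 0 := by
  have hUo : IsOpen {p : Fin (k + 2) → ℂ | ∀ i, p i ∈ ({0}ᶜ : Set ℂ)} :=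
    isOpen_setOf_forall_mem isOpen_compl_singleton
  have hUd : Dense {p : Fin (k + 2) → ℂ | ∀ i, p i ∈ ({0}ᶜ : Set ℂ)} :=
    dense_setOf_forall_mem (dense_compl_singleton 0)
  set U := {p : Fin (k + 2) → ℂ | ∀ i, p i ∈ ({0}ᶜ : Set ℂ)} with hU
  have hnz : ∀ t : Fin (k + 1) → ℂ, (∀ i, t i ≠ 0) → ∀ᶠ y in 𝓝 t, ∀ i, y i ≠ 0 := fun t ht =>
    (isOpen_setOf_forall_mem (n := k + 1) (isOpen_compl_singleton (x := (0 : ℂ)))).mem_nhds ht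
  have hW : ∀ s, AnalyticOnNhd ℂ (w s ∘ ratioTuple) (U ∩ ratioTuple ⁻¹' D s) := fun s p hp =>
    AnalyticAt.comp (hw s _ hp.2) (analyticAt_ratioTuple hp.1)
  have hmain := fderiv_eq_zero_of_chain hc hβ hβ' (Ω := fun s => U ∩ ratioTuple ⁻¹' D s)
    (fun s => ContinuousOn.isOpen_inter_preimage
      (fun p hp => (analyticAt_ratioTuple hp).continuousAt.continuousWithinAt) hUo (hD s))
    (fun s => dense_inter_preimage_of_section hUo hUd (hDd s) fun p hp =>
      ⟨fun t => p 0 • Fin.partialProd t,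
        (differentiable_partialProd.continuous.const_smul (p 0)).continuousAt,
        smul_partialProd_ratioTuple hp, by
        filter_upwards [hnz (ratioTuple p) fun i => div_ne_zero (hp _) (hp _)] with t ht
        exact ratioTuple_smul_partialProd ht (hp 0)⟩)
    hW (fun s p q hpq hp hq => h s p q hpq hp.1 hq.1 hp.2 hq.2)
  intro s t ht
  have ht0 := hD0 s t ht
  have hr : ∀ y : Fin (k + 1) → ℂ, (∀ i, y i ≠ 0) → ratioTuple (Fin.partialProd y) = y := by
    intro y hy
    simpa using ratioTuple_smul_partialProd hy one_ne_zero
  have hmem : Fin.partialProd t ∈ U ∩ ratioTuple ⁻¹' D s :=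
    ⟨partialProd_ne_zero ht0, by rwa [Set.mem_preimage, hr t ht0]⟩
  refine fderiv_eq_zero_of_section (r := ratioTuple) (differentiable_partialProd t) ?_
    (hW s _ hmem).differentiableAt (hmain s _ hmem)
  filter_upwards [hnz t ht0] with y hy using hr y hy

/-- The version of `fderiv_eq_zero_of_ratio_chain` in which the ratios are first transformed by
biholomorphic maps `θ s : A s → B s` with inverses `ψ s`. -/
theorem fderiv_eq_zero_of_transformed_chain {k : ℕ} {β : ℤ → ℂ} {c : ℂ} (hc : c ≠ 0)
    (hβ : ∀ s, ∀ t : ℕ, t < k + 1 → β s ≠ -β (s + t))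
    (hβ' : ∀ s, Function.Injective fun j : Fin (k + 2) => β (s - (j : ℕ)))
    {θ ψ : ℤ → ℂ → ℂ} {A B : ℤ → Set ℂ} (hA : ∀ s, IsOpen (A s)) (hAd : ∀ s, Dense (A s))
    (hA0 : ∀ s, ∀ t ∈ A s, t ≠ 0) (hB : ∀ s, IsOpen (B s)) (hBd : ∀ s, Dense (B s))
    (hθ : ∀ s, AnalyticOnNhd ℂ (θ s) (A s)) (hψ : ∀ s, DifferentiableOn ℂ (ψ s) (B s))
    (hθm : ∀ s, Set.MapsTo (θ s) (A s) (B s)) (hψm : ∀ s, Set.MapsTo (ψ s) (B s) (A s))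
    (hψθ : ∀ s, ∀ t ∈ A s, ψ s (θ s t) = t) (hθψ : ∀ s, ∀ x ∈ B s, θ s (ψ s x) = x)
    {D : ℤ → Set (Fin (k + 1) → ℂ)} (hD : ∀ s, IsOpen (D s)) (hDd : ∀ s, Dense (D s))
    {w : ℤ → (Fin (k + 1) → ℂ) → ℂ} (hw : ∀ s, AnalyticOnNhd ℂ (w s) (D s))
    (h : ∀ s p q, (p, q) ∈ shiftRelation k (β s) (β (s + 1)) c → (∀ i, p i ≠ 0) →
      (∀ i, q i ≠ 0) → (∀ i, ratioTuple p i ∈ A s) → (∀ i, ratioTuple q i ∈ A (s + 1)) →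
      (fun i => θ s (ratioTuple p i)) ∈ D s → (fun i => θ (s + 1) (ratioTuple q i)) ∈ D (s + 1) →
      w (s + 1) (fun i => θ (s + 1) (ratioTuple q i)) = w s (fun i => θ s (ratioTuple p i))) :
    ∀ s, ∀ x ∈ D s, fderiv ℂ (w s) x = 0 := by
  let V : ℤ → Set (Fin (k + 1) → ℂ) := fun s => {t | ∀ i, t i ∈ A s}
  let Θ : ℤ → (Fin (k + 1) → ℂ) → (Fin (k + 1) → ℂ) := fun s t i => θ s (t i)
  let Ψ : ℤ → (Fin (k + 1) → ℂ) → (Fin (k + 1) → ℂ) := fun s x i => ψ s (x i)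
  have hVo : ∀ s, IsOpen (V s) := fun s => isOpen_setOf_forall_mem (hA s)
  have hVd : ∀ s, Dense (V s) := fun s => dense_setOf_forall_mem (hAd s)
  have hBo : ∀ s, IsOpen {x : Fin (k + 1) → ℂ | ∀ i, x i ∈ B s} :=
    fun s => isOpen_setOf_forall_mem (hB s)
  have hΘ : ∀ s, ∀ t ∈ V s, AnalyticAt ℂ (Θ s) t := fun s t ht =>
    analyticAt_pi_iff.2 fun i => AnalyticAt.comp (g := θ s) (hθ s _ (ht i))
      ((ContinuousLinearMap.proj (R := ℂ) (φ := fun _ : Fin (k + 1) => ℂ) i).analyticAt t)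
  have hΨ : ∀ s, ∀ x : Fin (k + 1) → ℂ, (∀ i, x i ∈ B s) → DifferentiableAt ℂ (Ψ s) x :=
    fun s x hx => differentiableAt_pi.2 fun i =>
      ((hψ s).differentiableAt ((hB s).mem_nhds (hx i))).comp x (differentiableAt_apply i x)
  have hΘΨ : ∀ s, ∀ x : Fin (k + 1) → ℂ, (∀ i, x i ∈ B s) → Θ s (Ψ s x) = x :=
    fun s x hx => funext fun i => hθψ s _ (hx i)
  have hev : ∀ s, ∀ x : Fin (k + 1) → ℂ, (∀ i, x i ∈ B s) → ∀ᶠ y in 𝓝 x, Θ s (Ψ s y) = y :=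
    fun s x hx => ((hBo s).eventually_mem hx).mono fun y hy => hΘΨ s y hy
  have hW : ∀ s, AnalyticOnNhd ℂ (w s ∘ Θ s) (V s ∩ Θ s ⁻¹' D s) := fun s t ht =>
    AnalyticAt.comp (hw s _ ht.2) (hΘ s t ht.1)
  have hmain := fderiv_eq_zero_of_ratio_chain hc hβ hβ' (D := fun s => V s ∩ Θ s ⁻¹' D s)
    (fun s => ContinuousOn.isOpen_inter_preimage
      (fun t ht => (hΘ s t ht).continuousAt.continuousWithinAt) (hVo s) (hD s))
    (fun s => dense_inter_preimage_of_section (hVo s) (hVd s) (hDd s) fun t ht =>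
      ⟨Ψ s, (hΨ s _ fun i => hθm s (ht i)).continuousAt, funext fun i => hψθ s _ (ht i),
        hev s _ fun i => hθm s (ht i)⟩)
    (fun s t ht i => hA0 s _ (ht.1 i)) hW
    (fun s p q hpq hp hq hp' hq' => h s p q hpq hp hq hp'.1 hq'.1 hp'.2 hq'.2)
  intro s x hx
  -- Points of D s with coordinates outside B s are not reached by θ; there the derivative vanishes
  -- by continuity.
  refine eq_of_dense_of_eventually (dense_setOf_forall_mem (n := k + 1) (hBd s))
    (hw s x hx).fderiv.continuousAt (continuousAt_const (y := 0)) ?_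
  filter_upwards [(hD s).mem_nhds hx] with y hy hyB
  have hmem : Ψ s y ∈ V s ∩ Θ s ⁻¹' D s :=
    ⟨fun i => hψm s (hyB i), by rwa [Set.mem_preimage, hΘΨ s y hyB]⟩
  exact fderiv_eq_zero_of_section (r := Θ s) (hΨ s y hyB) (hev s y hyB)
    (hW s _ hmem).differentiableAt (hmain s _ hmem)

/-! ### Lower bounds for the orders -/

theorem geom_ne_neg {ρ b : ℂ} (hρ : ρ ≠ 0) (hb : b ≠ 0) {k : ℕ}
    (h : ∀ t : ℕ, t < k → ρ ^ t ≠ -1) (s : ℤ) (t : ℕ) (ht : t < k) :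
    b * ρ ^ s ≠ -(b * ρ ^ (s + t)) := by
  intro e
  rw [zpow_add₀ hρ, zpow_natCast] at e
  have h0 : b * ρ ^ s ≠ 0 := mul_ne_zero hb (zpow_ne_zero s hρ)
  exact h t ht (mul_left_cancel₀ h0 (by linear_combination e))

theorem geom_injective {ρ b : ℂ} (hρ : ρ ≠ 0) (hb : b ≠ 0) {k : ℕ}
    (h : ∀ d : ℕ, 1 ≤ d → d ≤ k → ρ ^ d ≠ 1) (s : ℤ) :
    Function.Injective fun j : Fin (k + 1) => b * ρ ^ (s - (j : ℕ)) := by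
  have key : ∀ i j : Fin (k + 1), i < j → b * ρ ^ (s - (i : ℕ)) ≠ b * ρ ^ (s - (j : ℕ)) := by
    intro i j hij e
    have hij' : (i : ℕ) < j := hij
    have hj := j.isLt
    have e' := mul_left_cancel₀ hb e
    rw [show s - ((i : ℕ) : ℤ) = s - ((j : ℕ) : ℤ) + (((j : ℕ) - (i : ℕ) : ℕ) : ℤ) by omega,
      zpow_add₀ hρ, zpow_natCast] at e'
    exact h ((j : ℕ) - i) (by omega) (by omega) (mul_left_cancel₀ (zpow_ne_zero _ hρ) (by rw [e', mul_one]))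
  intro i j hij
  rcases lt_trichotomy i j with h1 | h1 | h1
  · exact absurd hij (key i j h1)
  · exact h1
  · exact absurd hij.symm (key j i h1)

theorem pow_ne_neg_one {N : ℕ} {α : ℂ} (hmin : ∀ j : ℕ, 1 ≤ j → j < N → α ^ j ≠ -1) (t : ℕ)
    (ht : t < N) : α ^ t ≠ -1 := by
  rcases Nat.eq_zero_or_pos t with rfl | h
  · rw [pow_zero]; norm_num
  · exact hmin t h ht

/-- If α^d = 1, then α^{N-d} = -1 with a smaller exponent. -/
theorem pow_ne_one {N : ℕ} {α : ℂ} (hα : α ^ N = -1)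
    (hmin : ∀ j : ℕ, 1 ≤ j → j < N → α ^ j ≠ -1) (d : ℕ) (hd : 1 ≤ d) (hdN : d ≤ N) :
    α ^ d ≠ 1 := by
  intro h
  refine pow_ne_neg_one hmin (N - d) (by omega) ?_
  rw [← hα, ← mul_one (α ^ (N - d)), ← h, ← pow_add, Nat.sub_add_cancel hdN]

/-- A first integral in the first or second direction cannot have zero derivatives throughout. -/
theorem IsFamilyOfOrder.exists_fderiv_ne_zero {k : ℕ} {w : ℤ → ℤ → (Fin (k + 1) → ℂ) → ℂ}
    {D : ℤ → ℤ → Set (Fin (k + 1) → ℂ)} (h : IsFamilyOfOrder k w D) :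
    ∃ n m, ∃ x ∈ D n m, fderiv ℂ (w n m) x ≠ 0 := by
  obtain ⟨n, m, x, hx, hne⟩ := h.deriv_last
  exact ⟨n, m, x, hx, fun h0 => hne (by rw [h0, zero_apply])⟩

theorem exists_int_extension {K : ℕ} (n : ℤ) (f : Fin K → ℂ) :
    ∃ r : ℤ → ℂ, ∀ i : Fin K, r (n + (i : ℕ)) = f i := by
  have hinj : Function.Injective fun i : Fin K => n + ((i : ℕ) : ℤ) := fun i j hij => by
    simpa [Fin.ext_iff] using hij
  exact ⟨Function.extend (fun i : Fin K => n + ((i : ℕ) : ℤ)) f 0, fun i => hinj.extend_apply f 0 i⟩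

/-- Related tuples come from two adjacent rows of a solution of the linear equation. -/
theorem exists_linearSolution_rows {α : ℂ} (hα : α ≠ 0) {k : ℕ} {n m : ℤ}
    {p q : Fin (k + 2) → ℂ} (h : (p, q) ∈ shiftRelation k (-1 * α⁻¹ ^ m) (-1 * α⁻¹ ^ (m + 1))
      (α ^ (n - 1))) :
    ∃ v ∈ linearSolutions α, (∀ i : Fin (k + 2), v (n + (i : ℕ)) m = (α ^ m) ^ (i : ℕ) * p i) ∧
      ∀ i : Fin (k + 2), v (n + (i : ℕ)) (m + 1) = (α ^ (m + 1)) ^ (i : ℕ) * q i := by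
  obtain ⟨row, hrow⟩ := exists_int_extension n fun i : Fin (k + 2) => (α ^ m) ^ (i : ℕ) * p i
  -- Row m is given by p; row m + 1 obeys a first-order recurrence in n, so only its value q₀ at n
  -- has to be prescribed, through the default branch.
  obtain ⟨v, hv, hr, hc⟩ := exists_linearSolution hα n m row
    (fun j => if j = m then p 0 else q 0) (by simpa using hrow 0)
  have hf : ∀ i : Fin (k + 2), v (n + (i : ℕ)) m = (α ^ m) ^ (i : ℕ) * p i :=
    fun i => by rw [hr, hrow]
  refine ⟨v, hv, hf, fun i => ?_⟩
  induction i using Fin.induction with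
  | zero => simpa using hc (m + 1)
  | succ i ih =>
    have e := hv (n + (i : ℕ)) m
    have f0 := hf i.castSucc
    have f1 := hf i.succ
    have r := mem_shiftRelation.1 h i
    simp only [Fin.val_castSucc] at ih f0
    rw [Fin.val_succ, Nat.cast_succ, ← add_assoc] at f1
    rw [Fin.val_succ, Nat.cast_succ, ← add_assoc]
    rw [ih, f0, f1] at e
    have ha : α ^ m ≠ 0 := zpow_ne_zero m hα
    rw [zpow_add_one₀ (inv_ne_zero hα), inv_zpow, zpow_sub_one₀ hα] at r
    rw [zpow_add₀ hα n, zpow_natCast] at e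
    rw [zpow_add_one₀ hα] at e ⊢
    set a := α ^ m
    set b := α ^ n
    have r' : a * α * q i.succ + q i.castSucc = b * (a * p i.succ - p i.castSucc) := by
      field_simp at r
      linear_combination r
    simp only [mul_pow, pow_succ] at e ⊢
    linear_combination e - a ^ (i : ℕ) * α ^ (i : ℕ) * r'

/-- Related tuples come from three adjacent columns of a solution of the linear equation. -/
theorem exists_linearSolution_columns {α : ℂ} (hα : α ≠ 0) {l : ℕ} {n m : ℤ}
    {p q : Fin (l + 2) → ℂ} (h : (p, q) ∈ shiftRelation l (α ^ n) (α ^ (n + 1)) (-1)) :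
    ∃ v ∈ linearSolutions α,
      (∀ i : Fin (l + 1), v n (m + (i : ℕ)) = p i.succ - α ^ n * p i.castSucc) ∧
      (∀ i : Fin (l + 1), v (n + 1) (m + (i : ℕ)) = -(p i.succ + α ^ n * p i.castSucc)) ∧
      (∀ i : Fin (l + 1), v (n + 1) (m + (i : ℕ)) = q i.succ - α ^ (n + 1) * q i.castSucc) ∧
      ∀ i : Fin (l + 1), v (n + 1 + 1) (m + (i : ℕ)) =
        -(q i.succ + α ^ (n + 1) * q i.castSucc) := by
  obtain ⟨col, hcol⟩ := exists_int_extension m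
    fun i : Fin (l + 1) => p i.succ - α ^ n * p i.castSucc
  -- Column n and the values at height m in columns n + 1 and n + 2 (the latter through the default
  -- branch) determine these columns above m.
  obtain ⟨v, hv, hr, hc⟩ := exists_linearSolution hα n m
    (fun j => if j = n then p (Fin.succ 0) - α ^ n * p (Fin.castSucc 0) else if j = n + 1 then
      -(p (Fin.succ 0) + α ^ n * p (Fin.castSucc 0)) else
      -(q (Fin.succ 0) + α ^ (n + 1) * q (Fin.castSucc 0))) col
    (by simpa using (hcol 0).symm)
  -- The tuple p acts as a potential: with v_n = (S - α^n) p and v_{n+1} = -(S + α^n) p, the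
  -- equation (S - α^n) v_{n+1} = -(S + α^n) v_n holds because the operators commute.
  have hstep : ∀ (n : ℤ) (p : Fin (l + 2) → ℂ),
      (∀ i : Fin (l + 1), v n (m + (i : ℕ)) = p i.succ - α ^ n * p i.castSucc) →
      v (n + 1) m = -(p (Fin.succ 0) + α ^ n * p (Fin.castSucc 0)) →
      ∀ i : Fin (l + 1), v (n + 1) (m + (i : ℕ)) = -(p i.succ + α ^ n * p i.castSucc) := by
    intro n p hf h0 i
    induction i using Fin.induction with
    | zero => simpa using h0
    | succ i ih =>
      have e := hv n (m + (i : ℕ))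
      have f0 := hf i.castSucc
      have f1 := hf i.succ
      simp only [Fin.val_castSucc] at ih f0
      rw [Fin.val_succ, Nat.cast_succ, ← add_assoc] at f1
      rw [Fin.val_succ, Nat.cast_succ, ← add_assoc]
      rw [ih, f0, f1] at e
      rw [← Fin.succ_castSucc] at *
      linear_combination e
  have hf : ∀ i : Fin (l + 1), v n (m + (i : ℕ)) = p i.succ - α ^ n * p i.castSucc :=
    fun i => by rw [hc, hcol]
  have hg := hstep n p hf (by rw [hr]; simp)
  have hg' : ∀ i : Fin (l + 1), v (n + 1) (m + (i : ℕ)) =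
      q i.succ - α ^ (n + 1) * q i.castSucc := fun i => by
    rw [hg]; linear_combination -(mem_shiftRelation.1 h i)
  refine ⟨v, hv, hf, hg, hg', hstep (n + 1) q hg' ?_⟩
  rw [hr]
  simp [add_assoc]

/-- With n fixed and s = m as chain parameter, the rescaling v_{n+i,s} = (α^s)^i p_i removes the
factor α^i from the linear equation and yields β_s = -α^{-s}, c = α^{n-1}. It multiplies the ratios
by α^s, whence the choice of θ. -/
theorem le_of_mem_firstIntegralOrders₁ {N : ℕ} {α : ℂ} (hN : 1 ≤ N) (hα : α ^ N = -1)
    (hmin : ∀ j : ℕ, 1 ≤ j → j < N → α ^ j ≠ -1) {k : ℕ}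
    (hk : k ∈ firstIntegralOrders₁ (burgersSolutions α)) : N ≤ k := by
  have h0 : α ≠ 0 := by rintro rfl; rw [zero_pow (by omega)] at hα; norm_num at hα
  by_contra! hlt
  obtain ⟨w, D, hfam, hw⟩ := hk
  obtain ⟨n, m, x, hx, hne⟩ := hfam.exists_fderiv_ne_zero
  have hz : ∀ s : ℤ, α ^ s ≠ 0 := fun s => zpow_ne_zero s h0
  refine hne (fderiv_eq_zero_of_transformed_chain (β := fun s => -1 * α⁻¹ ^ s)
    (c := α ^ (n - 1)) (hz _)
    (geom_ne_neg (inv_ne_zero h0) (by norm_num) fun t ht h => ?_)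
    (geom_injective (inv_ne_zero h0) (by norm_num) fun d hd hd' h => ?_)
    (θ := fun s t => α ^ s * t) (ψ := fun s t => (α ^ s)⁻¹ * t) (A := fun _ => {0}ᶜ)
    (B := fun _ => {0}ᶜ) (fun _ => isOpen_compl_singleton) (fun _ => dense_compl_singleton 0)
    (fun _ _ ht => ht) (fun _ => isOpen_compl_singleton) (fun _ => dense_compl_singleton 0)
    (fun _ _ _ => analyticAt_const.mul analyticAt_id)
    (fun _ => (differentiable_id.const_mul _).differentiableOn)
    (fun s _ ht => mul_ne_zero (hz s) ht) (fun s _ ht => mul_ne_zero (inv_ne_zero (hz s)) ht)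
    (fun s _ _ => inv_mul_cancel_left₀ (hz s) _) (fun s _ _ => mul_inv_cancel_left₀ (hz s) _)
    (D := fun s => D n s) (fun s => hfam.isOpen n s) (fun s => hfam.dense n s)
    (w := fun s => w n s) (fun s => hfam.holomorphic n s) ?_ m x hx)
  · rw [inv_pow, inv_eq_iff_eq_inv, inv_neg, inv_one] at h
    exact pow_ne_neg_one hmin t (by omega) h
  · rw [inv_pow, inv_eq_one] at h
    exact pow_ne_one hα hmin d hd (by omega) h
  · intro s p q hpq hp hq _ _ hpD hqD
    obtain ⟨v, hv, hf, hg⟩ := exists_linearSolution_rows h0 hpq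
    have tup : ∀ (s : ℤ) (p : Fin (k + 2) → ℂ),
        (∀ i : Fin (k + 2), v (n + (i : ℕ)) s = (α ^ s) ^ (i : ℕ) * p i) →
        rowTuple (hopfCole v) k n s = fun i => α ^ s * ratioTuple p i := by
      intro s p hf
      ext i
      have f0 := hf i.castSucc
      have f1 := hf i.succ
      simp only [Fin.val_castSucc] at f0
      rw [Fin.val_succ, Nat.cast_succ, ← add_assoc, pow_succ] at f1
      rw [rowTuple, hopfCole, f0, f1, ratioTuple, mul_assoc, mul_div_mul_left _ _
        (pow_ne_zero _ (hz s)), mul_div_assoc]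
    have key := row_eq_of_linearSolution h0 hfam hw hv (n := n) (m := s)
      (fun i => by
        have := hf i.castSucc
        simp only [Fin.val_castSucc] at this
        rw [this]; exact mul_ne_zero (pow_ne_zero _ (hz s)) (hp _))
      (fun i => by
        have := hg i.castSucc
        simp only [Fin.val_castSucc] at this
        rw [this]; exact mul_ne_zero (pow_ne_zero _ (hz _)) (hq _))
    rw [tup s p hf, tup (s + 1) q hg] at key
    exact key hpD hqD

/-- With m fixed and s = n as chain parameter, column s is described by its potential p. Matching
the two expressions for column s + 1 is the shift relation with β_s = α^s, c = -1, and u is the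
Möbius image (α^s + t) / (α^s - t) of the ratio t = p_{i+1} / p_i. -/
theorem le_of_mem_firstIntegralOrders₂ {N : ℕ} {α : ℂ} (hN : 1 ≤ N) (hα : α ^ N = -1)
    (hmin : ∀ j : ℕ, 1 ≤ j → j < N → α ^ j ≠ -1) {l : ℕ}
    (hl : l ∈ firstIntegralOrders₂ (burgersSolutions α)) : N ≤ l := by
  have h0 : α ≠ 0 := by rintro rfl; rw [zero_pow (by omega)] at hα; norm_num at hα
  by_contra! hlt
  obtain ⟨w, D, hfam, hw⟩ := hl
  obtain ⟨n, m, x, hx, hne⟩ := hfam.exists_fderiv_ne_zero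
  have hz : ∀ s : ℤ, α ^ s ≠ 0 := fun s => zpow_ne_zero s h0
  have hopen : ∀ a b c : ℂ, IsOpen ({a, b, c}ᶜ : Set ℂ) := fun a b c =>
    (Set.toFinite _).isClosed.isOpen_compl
  have hdense : ∀ a b c : ℂ, Dense ({a, b, c}ᶜ : Set ℂ) := fun a b c =>
    (Set.toFinite ({a, b, c} : Set ℂ)).countable.dense_compl ℂ
  have hmem : ∀ {a b c t : ℂ}, t ∈ ({a, b, c}ᶜ : Set ℂ) ↔ t ≠ a ∧ t ≠ b ∧ t ≠ c := by simp
  have hadd : ∀ {c : ℂ}, c ≠ -1 → c + 1 ≠ 0 := fun hc h => hc (eq_neg_of_add_eq_zero_left h)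
  have hsub : ∀ {s : ℤ} {t : ℂ}, t ≠ α ^ s → α ^ s - t ≠ 0 := fun h => sub_ne_zero.2 h.symm
  have hadd' : ∀ {s : ℤ} {t : ℂ}, t ≠ -α ^ s → α ^ s + t ≠ 0 := fun h h' =>
    h (by linear_combination h')
  have hβ := geom_ne_neg (k := l + 1) h0 one_ne_zero fun t ht =>
    pow_ne_neg_one hmin t (by omega)
  have hβ' := geom_injective (k := l + 1) h0 one_ne_zero fun d hd hd' =>
    pow_ne_one hα hmin d hd (by omega)
  simp only [one_mul] at hβ hβ'
  have key := fderiv_eq_zero_of_transformed_chain (k := l) (β := fun s => α ^ s) (c := -1)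
    (by norm_num)
    hβ hβ'
    (θ := fun s t => (α ^ s + t) / (α ^ s - t)) (ψ := fun s x => α ^ s * ((x - 1) / (x + 1)))
    (A := fun s => {0, α ^ s, -α ^ s}ᶜ) (B := fun _ => {0, 1, -1}ᶜ)
    (fun _ => hopen _ _ _) (fun _ => hdense _ _ _) (fun _ _ ht => (hmem.1 ht).1)
    (fun _ => hopen _ _ _) (fun _ => hdense _ _ _)
    (fun s t ht => (analyticAt_const.add analyticAt_id).div (analyticAt_const.sub analyticAt_id)
      (hsub (hmem.1 ht).2.1))
    (fun s x hx => by
      have d1 : DifferentiableAt ℂ (fun y : ℂ => y - 1) x := differentiableAt_id.sub_const 1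
      have d2 : DifferentiableAt ℂ (fun y : ℂ => y + 1) x := differentiableAt_id.add_const 1
      exact ((d1.div d2 (hadd (hmem.1 hx).2.2)).const_mul (α ^ s)).differentiableWithinAt)
    (fun s t ht => by
      obtain ⟨t0, t1, t2⟩ := hmem.1 ht
      have h1 := hsub t1
      refine hmem.2 ⟨div_ne_zero (hadd' t2) h1, fun h => t0 ?_, fun h => hz s ?_⟩
      · rw [div_eq_iff h1] at h; linear_combination h / 2
      · rw [div_eq_iff h1] at h; linear_combination h / 2)
    (fun s x hx => by
      obtain ⟨x0, x1, x2⟩ := hmem.1 hx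
      have h1 := hadd x2
      have h2 := hz s
      refine hmem.2 ⟨mul_ne_zero h2 (div_ne_zero (sub_ne_zero.2 x1) h1), fun h => ?_,
        fun h => x0 ?_⟩
      · have h3 := (mul_eq_left₀ h2).1 h
        rw [div_eq_iff h1] at h3
        exact two_ne_zero (α := ℂ) (by linear_combination -h3)
      · have h3 : (x - 1) / (x + 1) = -1 := mul_left_cancel₀ h2 (h.trans (by ring))
        rw [div_eq_iff h1] at h3
        linear_combination h3 / 2)
    (fun s t ht => by
      have h1 := hsub (hmem.1 ht).2.1
      have h2 := hz s
      have e1 : (α ^ s + t) / (α ^ s - t) - 1 = 2 * t / (α ^ s - t) := by field_simp; ring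
      have e2 : (α ^ s + t) / (α ^ s - t) + 1 = 2 * α ^ s / (α ^ s - t) := by field_simp; ring
      simp only [e1, e2]
      field_simp)
    (fun s x hx => by
      have h1 := hadd (hmem.1 hx).2.2
      have h2 := hz s
      have e1 : α ^ s + α ^ s * ((x - 1) / (x + 1)) = 2 * α ^ s * x / (x + 1) := by
        field_simp; ring
      have e2 : α ^ s - α ^ s * ((x - 1) / (x + 1)) = 2 * α ^ s / (x + 1) := by
        field_simp; ring
      simp only [e1, e2]
      field_simp)
    (D := fun s => D s m) (fun s => hfam.isOpen s m) (fun s => hfam.dense s m)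
    (w := fun s => w s m) (fun s => hfam.holomorphic s m)
    (fun s p q hpq hp hq hpA hqA hpD hqD => by
      obtain ⟨v, hv, hf, hg, hg', hh⟩ := exists_linearSolution_columns h0 (m := m) hpq
      have hne : ∀ (s : ℤ) (p : Fin (l + 2) → ℂ), (∀ i, p i ≠ 0) →
          (∀ i, ratioTuple p i ∈ ({0, α ^ s, -α ^ s}ᶜ : Set ℂ)) →
          ∀ i : Fin (l + 1), p i.succ - α ^ s * p i.castSucc ≠ 0 := fun s p hp hpA i h =>
        (hmem.1 (hpA i)).2.1 (by rw [ratioTuple, div_eq_iff (hp _)]; linear_combination h)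
      have tup : ∀ (s : ℤ) (p : Fin (l + 2) → ℂ), (∀ i, p i ≠ 0) →
          (∀ i, ratioTuple p i ∈ ({0, α ^ s, -α ^ s}ᶜ : Set ℂ)) →
          (∀ i : Fin (l + 1), v s (m + (i : ℕ)) = p i.succ - α ^ s * p i.castSucc) →
          (∀ i : Fin (l + 1), v (s + 1) (m + (i : ℕ)) = -(p i.succ + α ^ s * p i.castSucc)) →
          colTuple (hopfCole v) l s m =
            fun i => (α ^ s + ratioTuple p i) / (α ^ s - ratioTuple p i) := by
        intro s p hp hpA hf hg
        ext i
        rw [colTuple, hopfCole, hf, hg, div_eq_div_iff (hne s p hp hpA i)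
          (hsub (hmem.1 (hpA i)).2.1), ratioTuple]
        have := hp i.castSucc
        field_simp
        ring
      have key := col_eq_of_linearSolution h0 hfam hw hv (n := s) (m := m)
        (fun i => by rw [hf]; exact hne s p hp hpA i)
        (fun i => by rw [hg']; exact hne (s + 1) q hq hqA i)
      rw [tup s p hp hpA hf hg, tup (s + 1) q hq hqA hg' hh] at key
      exact key hpD hqD)
  exact hne (key n x hx)

/-! ### Minimal orders and conclusion -/

theorem exists_isLeast_of_succ_mem {S : Set ℕ} {N : ℕ} (h : N + 1 ∈ S) (hS : ∀ k ∈ S, N ≤ k) :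
    ∃ k, IsLeast S k ∧ (k = N ∨ k = N + 1) := by
  have h1 := Nat.sInf_mem ⟨_, h⟩
  have h2 := Nat.sInf_le h
  have h3 := hS _ h1
  exact ⟨sInf S, ⟨h1, fun k hk => Nat.sInf_le hk⟩, by omega⟩

/-- A primitive 2N-th root of unity works: its N-th power is a square root of 1 other than 1, and
α^j = -1 would force α^{2j} = 1. -/
theorem exists_primitive_root_neg_one {N : ℕ} (hN : 1 ≤ N) :
    ∃ α : ℂ, α ^ N = -1 ∧ ∀ j : ℕ, 1 ≤ j → j < N → α ^ j ≠ -1 := by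
  have hprim := Complex.isPrimitiveRoot_exp (2 * N) (by omega)
  set α := Complex.exp (2 * Real.pi * Complex.I / (2 * N : ℕ))
  refine ⟨α, ?_, fun j hj hjN h => ?_⟩
  · have h1 : (α ^ N) ^ 2 = 1 := by rw [← pow_mul, mul_comm, hprim.pow_eq_one]
    exact (mul_self_eq_one_iff.1 (by rw [← sq, h1])).resolve_left
      (hprim.pow_ne_one_of_pos_of_lt (by omega) (by omega))
  · refine hprim.pow_ne_one_of_pos_of_lt (l := 2 * j) (by omega) (by omega) ?_
    rw [mul_comm, pow_mul, h]; norm_num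

theorem burgers_darboux {N : ℕ} {α : ℂ} (hN : 1 ≤ N) (hα : α ^ N = -1)
    (hmin : ∀ j : ℕ, 1 ≤ j → j < N → α ^ j ≠ -1) :
    IsDarbouxIntegrable (burgersSolutions α) ∧
      IsFirstIntegral₁ (burgersSolutions α) (N + 1) (burgersIntegral₁ N α) ∧
      IsFirstIntegral₂ (burgersSolutions α) (N + 1) (burgersIntegral₂ N α) ∧
      (∃ k, IsLeast (firstIntegralOrders₁ (burgersSolutions α)) k ∧ (k = N ∨ k = N + 1)) ∧
      (∃ l, IsLeast (firstIntegralOrders₂ (burgersSolutions α)) l ∧ (l = N ∨ l = N + 1)) := by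
  have h1 := isFirstIntegral₁_burgersIntegral₁ hN hα
  have h2 := isFirstIntegral₂_burgersIntegral₂ hN hα
  exact ⟨⟨⟨_, _, h1⟩, _, _, h2⟩, h1, h2,
    exists_isLeast_of_succ_mem ⟨_, h1⟩ fun k hk => le_of_mem_firstIntegralOrders₁ hN hα hmin hk,
    exists_isLeast_of_succ_mem ⟨_, h2⟩ fun l hl => le_of_mem_firstIntegralOrders₂ hN hα hmin hl⟩

theorem mainTheorem1 :
    (∀ (N : ℕ) (α : ℂ), 1 ≤ N → α ^ N = -1 → (∀ j : ℕ, 1 ≤ j → j < N → α ^ j ≠ -1) →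
      IsDarbouxIntegrable (burgersSolutions α) ∧
      IsFirstIntegral₁ (burgersSolutions α) (N + 1) (burgersIntegral₁ N α) ∧
      IsFirstIntegral₂ (burgersSolutions α) (N + 1) (burgersIntegral₂ N α) ∧
      (∃ k, IsLeast (firstIntegralOrders₁ (burgersSolutions α)) k ∧ (k = N ∨ k = N + 1)) ∧
      (∃ l, IsLeast (firstIntegralOrders₂ (burgersSolutions α)) l ∧ (l = N ∨ l = N + 1))) ∧
    (∀ M : ℕ, ∃ α : ℂ, α ≠ 0 ∧ IsDarbouxIntegrable (burgersSolutions α) ∧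
      (∃ k, IsLeast (firstIntegralOrders₁ (burgersSolutions α)) k ∧ M ≤ k) ∧
      (∃ l, IsLeast (firstIntegralOrders₂ (burgersSolutions α)) l ∧ M ≤ l)) := by
  refine ⟨fun N α hN hα hmin => burgers_darboux hN hα hmin, fun M => ?_⟩
  obtain ⟨α, hα, hmin⟩ := exists_primitive_root_neg_one (N := M + 1) (by omega)
  obtain ⟨hD, -, -, ⟨k, hk, hk'⟩, l, hl, hl'⟩ := burgers_darboux (by omega) hα hmin
  refine ⟨α, ?_, hD, ⟨k, hk, by omega⟩, l, hl, by omega⟩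
  rintro rfl
  rw [zero_pow (by omega)] at hα
  norm_num at hα
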